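/- **Setting.** Let $f:\mathbb R^d\to\mathbb R$ be differentiable, with $\|\nabla f(x)-\nabla f(y)\|\le L\|x-y\|$ ($L$-smooth) and $f(y)\ge f(x)+\langle\nabla f(x),y-x\rangle+\frac{\mu}{2}\|y-x\|^2$ ($\mu$-strongly convex, $\mu>0$) for all $x,y$, and let $w^*$ be its minimizer. Let $0<k\le d$, $W\ge1$ (number of workers), $T\ge1$. *Count Sketch.* With $r$ rows and $c$ columns, the sketch of $x\in\mathbb R^d$ is the table $S(x)_{j,b}=\sum_{i:\,h_j(i)=b}s_j(i)\,x_i$, where the rows use independent bucket hashes $h_j:[d]\to[c]$ and sign hashes $s_j:[d]\to\{\pm1\}$, drawn uniformly from a finite pairwise independent family and a finite 4-wise independent family respectively. From a table $S$ one estimates the squared norm by $\hat\ell^2=\mathrm{median}_j\sum_b S_{j,b}^2$ and the coordinates by $\hat x_i=\mathrm{median}_j\, s_j(i)S_{j,h_j(i)}$. *HeavyMix$(S,k)$* selects the coordinates $\mathrm{Top}_k=H\cup R$, where $H=\{i:\hat x_i^2\ge\hat\ell^2/k\}$ and $R$ is a uniformly random set of $k-|H|$ coordinates outside $H$; if $|H|>k$,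 a uniformly random $k$-element subset of $H$ is selected. *Sketched-SGD.* Fix $w_1\in\mathbb R^d$ and errors $a^i_0=0$, $1\le i\le W$. For $t=1,\dots,T$: worker $i$ computes a stochastic gradient $g^i_t$ and $\bar g^i_t=\eta_t g^i_t+a^i_{t-1}$ and sends the sketch of $\bar g^i_t$; the server averages the sketches, runs HeavyMix on the average table, obtains the exact values of $\bar g_t=\frac1W\sum_i\bar g^i_t$ on $\mathrm{Top}_k$, and forms $\tilde g_t$, equal to $\bar g_t$ on $\mathrm{Top}_k$ and $0$ elsewhere; then $w_{t+1}=w_t-\tilde g_t$ and $a^i_t=\bar g^i_t-\tilde g_t$. All workers share the hash functions of an iteration; the sketching randomness (hash functions and random selection) of iteration $t$ is independent of all gradients of iterations $\le t$ and all sketching randomness of earlier iterations. The output is $\hat w_T=\frac1{Q_T}\sum_{t=1}^T(\xi+t)^2w_t$ with $Q_T=\sum_{t=1}^T(\xi+t)^2$. *Stochastic gradients.* Let $g_t=\frac1W\sum_i g^i_t$ and let $\mathcal H_t$ be generated by the gradients and the sketching randomness of iterations $1,\dots,t-1$. Assume that $g_t$ is square integrable and, almost surely, $\mathbb E[g_t\mid\mathcal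 H_t]=\nabla f(w_t)$, $\mathbb E[\|g_t\|^2\mid\mathcal H_t]\le G^2$ and $\mathbb E[\|g_t-\nabla f(w_t)\|^2\mid\mathcal H_t]\le\sigma^2$ for $1\le t\le T$, where $G,\sigma\ge0$. *Step sizes.* $\eta_t=\frac{\gamma}{t+\xi}$ with $8\le\gamma\mu\le A$ and $2+\frac{d(1+\beta)}{k(1+\rho)}<\xi\le A\,\frac dk$, where $\beta>4$ and $\rho=\frac{4\beta}{(\beta-4)(\beta+1)^2}$. **Theorem.** There is an absolute constant $c_0>0$ such that the following hold. 1. For all $\beta>4$ and $A$ there is a constant $C$, depending only on $\beta$ and $A$, such that whenever $c\ge c_0k$ and $r\ge c_0(1+\log(dT))$, the random variable $f(\hat w_T)$ is integrable and $$\mathbb E\,f(\hat w_T)-f(w^*)\le C\left(\frac{\sigma^2}{\mu T}+\frac{d^2G^2L}{k^2\mu^2T^2}+\frac{d^3G^3}{k^3\mu T^3}\right),$$ where the expectation is over both the stochastic gradients and the sketching randomness. 2. If moreover $c\le Ak$ and $r\le A(1+\log(dT))$, so that the sketch has $\Theta(k\log(dT))$ counters, and a number is transmitted in $b\ge1$ bits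 and a coordinate in $\lceil\log_2d\rceil$ bits, then the total communication per update (sketches, request and answer for the exact values on $\mathrm{Top}_k$, and $\tilde g_t$ sent to every worker) lies between $m\,k(1+\log(dT))W$ and $M\,k(1+\log(dT))W$ bits, with constants $m,M>0$ depending only on $A$ and $b$. -/

import Mathlib

open MeasureTheory ProbabilityTheory

noncomputable section

namespace SketchedSGD

/-! ## Smooth strongly convex functions -/

/-- `f : ℝ^d → ℝ` is differentiable, `L`-smooth and `μ`-strongly convex. -/
structure IsSmoothStronglyConvex {d : ℕ} (f : EuclideanSpace ℝ (Fin d) → ℝ) (L μ : ℝ) : Prop where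
  differentiable : Differentiable ℝ f
  smooth : ∀ x y, ‖gradient f y - gradient f x‖ ≤ L * ‖y - x‖
  strongly_convex : ∀ x y,
    f x + inner ℝ (gradient f x) (y - x) + μ / 2 * ‖y - x‖ ^ 2 ≤ f y

/-! ## Count Sketch -/

/-- A family of functions `h θ : Fin d → R`, with `θ` uniform on a finite seed set, is `m`-wise
independent: on any set of at most `m` coordinates its values are independent and uniform. -/
def KWiseIndependent {Θ R : Type} [Fintype Θ] [Fintype R] [DecidableEq R] {d : ℕ}
    (m : ℕ) (h : Θ → Fin d → R) : Prop :=
  ∀ S : Finset (Fin d), S.card ≤ m → ∀ a : Fin d → R,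
    (Finset.univ.filter fun θ => ∀ i ∈ S, h θ i = a i).card * Fintype.card R ^ S.card
      = Fintype.card Θ

/-- The hash functions that a Count Sketch on `ℝ^d` with `c` columns draws from: a pairwise
independent family of bucket hashes and a four-wise independent family of sign hashes. -/
structure HashFamily (d c : ℕ) where
  numBucket : ℕ
  numSign : ℕ
  numBucket_pos : 0 < numBucket
  numSign_pos : 0 < numSign
  bucket : Fin numBucket → Fin d → Fin c
  sign : Fin numSign → Fin d → ℤˣ
  bucket_indep : KWiseIndependent 2 bucket
  sign_indep : KWiseIndependent 4 sign

/-- The random seed of one iteration: a bucket hash and a sign hash for each of the `r` rows, and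
an ordering of the coordinates, used for the random selection in `heavyMix`. -/
abbrev Seed {d c : ℕ} (F : HashFamily d c) (r : ℕ) : Type :=
  (Fin r → Fin F.numBucket) × (Fin r → Fin F.numSign) × Equiv.Perm (Fin d)

/-- The median of `r` real numbers (the mean of the two middle ones when `r` is even). -/
def median {r : ℕ} (v : Fin r → ℝ) : ℝ :=
  if h : 0 < r then
    (v (Tuple.sort v ⟨(r - 1) / 2, by omega⟩) + v (Tuple.sort v ⟨r / 2, by omega⟩)) / 2
  else 0

variable {d c r W : ℕ}

/-- The `r × c` table of counters of the Count Sketch of `x`. -/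
def countSketch (F : HashFamily d c) (θ : Seed F r) (x : EuclideanSpace ℝ (Fin d)) :
    Fin r → Fin c → ℝ :=
  fun j b => ∑ i with F.bucket (θ.1 j) i = b, ((F.sign (θ.2.1 j) i : ℤ) : ℝ) * x i

/-- The estimate of the squared norm of the sketched vector. -/
def normSqEstimate (S : Fin r → Fin c → ℝ) : ℝ :=
  median fun j => ∑ b, S j b ^ 2

/-- The estimate of the `i`-th coordinate of the sketched vector. -/
def coordEstimate (F : HashFamily d c) (θ : Seed F r) (S : Fin r → Fin c → ℝ) (i : Fin d) : ℝ :=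
  median fun j => ((F.sign (θ.2.1 j) i : ℤ) : ℝ) * S j (F.bucket (θ.1 j) i)

/-! ## HeavyMix -/

/-- The set of coordinates that look heavy in the sketch `S`. -/
def heavy (F : HashFamily d c) (θ : Seed F r) (k : ℕ) (S : Fin r → Fin c → ℝ) :
    Finset (Fin d) :=
  Finset.univ.filter fun i => normSqEstimate S / k ≤ coordEstimate F θ S i ^ 2

/-- The first `l` elements of `B` in the ordering `π` (all of `B` if `B` has at most `l` elements).
For uniform `π` it is a uniformly random `l`-element subset of `B`. -/
def firstOf (π : Equiv.Perm (Fin d)) (l : ℕ) (B : Finset (Fin d)) : Finset (Fin d) :=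
  B.filter fun i => (B.filter fun j => π j < π i).card < l

/-- The index set `Top_k = H ∪ rand_l (NH)`, `l = k - |H|`, that HeavyMix selects from a sketch;
if more than `k` coordinates look heavy, a random `k` of them are kept. -/
def heavyMix (F : HashFamily d c) (θ : Seed F r) (k : ℕ) (S : Fin r → Fin c → ℝ) :
    Finset (Fin d) :=
  firstOf θ.2.2 k (heavy F θ k S) ∪
    firstOf θ.2.2 (k - (heavy F θ k S).card) (heavy F θ k S)ᶜ

/-- The vector that agrees with `x` on `I` and vanishes elsewhere. -/
def restrict (I : Finset (Fin d)) (x : EuclideanSpace ℝ (Fin d)) : EuclideanSpace ℝ (Fin d) :=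
  WithLp.toLp 2 fun i => if i ∈ I then x i else 0

/-- The average of the workers' vectors. -/
def average {V : Type*} [AddCommMonoid V] [Module ℝ V] (x : Fin W → V) : V :=
  (1 / (W : ℝ)) • ∑ i, x i

/-! ## The algorithm -/

/-- The current parameters, and the error vector accumulated by each worker. -/
structure State (d W : ℕ) where
  w : EuclideanSpace ℝ (Fin d)
  err : Fin W → EuclideanSpace ℝ (Fin d)

/-- Error correction: worker `i` adds its error vector to its scaled stochastic gradient. -/
def corrected (η : ℝ) (g : Fin W → EuclideanSpace ℝ (Fin d)) (s : State d W) (i : Fin W) :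
    EuclideanSpace ℝ (Fin d) :=
  η • g i + s.err i

/-- The coordinates that the parameter server recovers from the average of the workers'
sketches. -/
def selected (F : HashFamily d c) (k : ℕ) (θ : Seed F r) (η : ℝ)
    (g : Fin W → EuclideanSpace ℝ (Fin d)) (s : State d W) : Finset (Fin d) :=
  heavyMix F θ k (average fun i => countSketch F θ (corrected η g s i))

/-- The update vector: the exact average on the selected coordinates, and zero elsewhere. -/
def update (F : HashFamily d c) (k : ℕ) (θ : Seed F r) (η : ℝ)
    (g : Fin W → EuclideanSpace ℝ (Fin d)) (s : State d W) : EuclideanSpace ℝ (Fin d) :=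
  restrict (selected F k θ η g s) (average (corrected η g s))

/-- One iteration of Sketched-SGD. -/
def step (F : HashFamily d c) (k : ℕ) (θ : Seed F r) (η : ℝ)
    (g : Fin W → EuclideanSpace ℝ (Fin d)) (s : State d W) : State d W where
  w := s.w - update F k θ η g s
  err i := corrected η g s i - update F k θ η g s

/-- `state n` is the state after `n` iterations, from the starting point `w₁` and zero errors;
iteration `t = 1, 2, …` uses the step size `η t`, the stochastic gradients `g t` and the
seed `θ t`. -/
def state (F : HashFamily d c) (k : ℕ) (η : ℕ → ℝ) (w₁ : EuclideanSpace ℝ (Fin d))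
    (g : ℕ → Fin W → EuclideanSpace ℝ (Fin d)) (θ : ℕ → Seed F r) : ℕ → State d W
  | 0 => ⟨w₁, fun _ => 0⟩
  | n + 1 => step F k (θ (n + 1)) (η (n + 1)) (g (n + 1)) (state F k η w₁ g θ n)

/-- The iterate `w_t`, `t = 1, 2, …`, at which the gradients of iteration `t` are taken. -/
def iterate (F : HashFamily d c) (k : ℕ) (η : ℕ → ℝ) (w₁ : EuclideanSpace ℝ (Fin d))
    (g : ℕ → Fin W → EuclideanSpace ℝ (Fin d)) (θ : ℕ → Seed F r) (t : ℕ) :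
    EuclideanSpace ℝ (Fin d) :=
  (state F k η w₁ g θ (t - 1)).w

/-- The output `(∑ (ξ + t)²)⁻¹ ∑ (ξ + t)² w_t`, with both sums over `1 ≤ t ≤ T`. -/
def output (F : HashFamily d c) (k : ℕ) (η : ℕ → ℝ) (ξ : ℝ) (w₁ : EuclideanSpace ℝ (Fin d))
    (g : ℕ → Fin W → EuclideanSpace ℝ (Fin d)) (θ : ℕ → Seed F r) (T : ℕ) :
    EuclideanSpace ℝ (Fin d) :=
  (1 / ∑ t ∈ Finset.Icc 1 T, (ξ + t) ^ 2) •
    ∑ t ∈ Finset.Icc 1 T, (ξ + t) ^ 2 • iterate F k η w₁ g θ t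

/-! ## Communication -/

/-- The messages exchanged between a worker and the parameter server. -/
inductive Message (d r c : ℕ) where
  /-- The worker sends its table of counters. -/
  | sketch (S : Fin r → Fin c → ℝ)
  /-- The server asks for the exact values of the coordinates in `I`. -/
  | request (I : Finset (Fin d))
  /-- The worker answers with these values. -/
  | values (I : Finset (Fin d)) (v : I → ℝ)
  /-- The server sends a sparse vector, as pairs of a coordinate and a value. -/
  | sparse (I : Finset (Fin d)) (v : I → ℝ)

/-- The length of a message in bits, with `b` bits for a number and `⌈log₂ d⌉` bits for a
coordinate. -/
def Message.bits (b : ℕ) : Message d r c → ℕ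
  | .sketch _ => r * c * b
  | .request I => I.card * Nat.clog 2 d
  | .values I _ => I.card * b
  | .sparse I _ => I.card * (Nat.clog 2 d + b)

/-- The messages between worker `i` and the server in one iteration. -/
def messages (F : HashFamily d c) (k : ℕ) (θ : Seed F r) (η : ℝ)
    (g : Fin W → EuclideanSpace ℝ (Fin d)) (s : State d W) (i : Fin W) :
    List (Message d r c) :=
  [.sketch (countSketch F θ (corrected η g s i)),
    .request (selected F k θ η g s),
    .values (selected F k θ η g s) (fun j => corrected η g s i j),
    .sparse (selected F k θ η g s) (fun j => update F k θ η g s j)]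

/-- The total number of bits communicated in one iteration. -/
def communication (b : ℕ) (F : HashFamily d c) (k : ℕ) (θ : Seed F r) (η : ℝ)
    (g : Fin W → EuclideanSpace ℝ (Fin d)) (s : State d W) : ℕ :=
  ∑ i, ((messages F k θ η g s i).map (Message.bits b)).sum

/-! ## The history -/

/-- The σ-algebra generated by the stochastic gradients of iteration `t`. -/
abbrev gradientInfo {Ω : Type*} (g : ℕ → Fin W → Ω → EuclideanSpace ℝ (Fin d)) (t : ℕ) :
    MeasurableSpace Ω :=
  ⨆ i, MeasurableSpace.comap (g t i) inferInstance

/-- The σ-algebra generated by the stochastic gradients and the seeds of the iterations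
`1, …, t - 1`. -/
abbrev history {Ω : Type*} {F : HashFamily d c} (g : ℕ → Fin W → Ω → EuclideanSpace ℝ (Fin d))
    (θ : ℕ → Ω → Seed F r) (t : ℕ) : MeasurableSpace Ω :=
  ⨆ s ∈ Set.Ico 1 t, gradientInfo g s ⊔ MeasurableSpace.comap (θ s) ⊤

end SketchedSGD

end

/-! Count Sketch is linear, so the average of the workers' sketches is the sketch of the averaged
vector x = η g + a, with g the mean gradient and a the mean of the error vectors. The workers thus
behave like a single process with one error vector, compressed by `compress`.

The heart is that this compression contracts on average: over a fresh seed, E‖x - compress x‖² ≤ (1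
- τ)‖x‖² with τ = k/(16d) (`sum_norm_sub_restrict_heavyMix_le`). Moments of the hashes and
Chebyshev's inequality make each estimate from a single row accurate with probability at least
99/100; medians and a union bound over d + 1 estimates make all of them accurate with probability at
least 1/2. Then every coordinate declared heavy carries at least a share 1/(4k) of ‖x‖², and either
at least k/2 coordinates are heavy or more than k/2 slots are filled at random. Either way a share
k/(8d) is captured on average. Failed seeds do no harm, since dropping coordinates never increases a
norm.

The rest is stochastic gradient descent with error feedback. The virtual iterate w - a moves exactly
by -η g, so its squared distance to the minimizer obeys the usual recursion, with an extra term 9 L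
η E‖a‖² because gradients are taken at w (`integral_descent_step`). The contraction keeps E‖a‖² of
order (d/k)² η² G² (`integral_meanError_sq_le`). With weights (ξ + t)² the recursion telescopes
(`weighted_sum_le`), and Jensen's inequality passes to the averaged output. In `rate_le` the
gradient noise becomes σ²/(μT), while the error memory and the initial distance both become
d²G²L/(k²μ²T²); the cubic term of the theorem is nonnegative slack.

For the communication, the r c b bits of each sketch are of order k log(dT), and the other messages
concern at most k coordinates. -/

namespace SketchedSGD

/-! ## Moments of the hash functions -/

section Hash

variable {Θ R : Type} [Fintype Θ] [Fintype R] [DecidableEq R] {d m : ℕ}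

/-- A statistic of at most `m` hash values has the same mean as under independent uniform values.
Denominators are cleared, so that only seeds are counted. -/
theorem KWiseIndependent.sum_comp [Nonempty R] {h : Θ → Fin d → R} (hh : KWiseIndependent m h)
    (S : Finset (Fin d)) (hS : S.card ≤ m) (F : (S → R) → ℝ) :
    (∑ θ, F fun i => h θ i) * (Fintype.card R : ℝ) ^ S.card = Fintype.card Θ * ∑ b, F b := by
  classical
  have key : ∀ b : S → R, ((Finset.univ.filter fun θ => (fun i : S => h θ i) = b).card : ℝ)
      * (Fintype.card R : ℝ) ^ S.card = Fintype.card Θ := by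
    intro b
    -- Values off `S` are irrelevant; the default merely completes `b` to all coordinates.
    have := hh S hS (fun i => if hi : i ∈ S then b ⟨i, hi⟩ else Classical.arbitrary R)
    rw [← this]
    push_cast
    congr 3
    ext θ
    simp only [Finset.mem_filter, Finset.mem_univ, true_and, funext_iff, Subtype.forall]
    refine forall_congr' fun i => forall_congr' fun hi => ?_
    simp [hi]
  have h1 : ∑ θ, F (fun i => h θ i)
      = ∑ b : S → R, ((Finset.univ.filter fun θ => (fun i : S => h θ i) = b).card : ℝ) * F b := by
    rw [← Finset.sum_fiberwise (s := Finset.univ) (g := fun θ => fun i : S => h θ i)]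
    refine Finset.sum_congr rfl fun b _ => ?_
    rw [Finset.sum_congr rfl (g := fun _ => F b)]
    · simp
    · intro θ hθ
      rw [(Finset.mem_filter.1 hθ).2]
  rw [h1, Finset.sum_mul, Finset.mul_sum]
  refine Finset.sum_congr rfl fun b _ => ?_
  rw [mul_right_comm, key]

theorem KWiseIndependent.mono {m' : ℕ} {h : Θ → Fin d → R} (hh : KWiseIndependent m h)
    (hm : m' ≤ m) : KWiseIndependent m' h :=
  fun S hS => hh S (hS.trans hm)

/-- Under independent uniform signs the sum factors over `S`, and each factor is 1 + (-1) = 0. -/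
theorem KWiseIndependent.sum_prod_sign {s : Θ → Fin d → ℤˣ} (hs : KWiseIndependent m s)
    (S : Finset (Fin d)) (hS : S.card ≤ m) (hne : S.Nonempty) :
    ∑ θ, ∏ i ∈ S, ((s θ i : ℤ) : ℝ) = 0 := by
  classical
  have h := hs.sum_comp S hS (fun b => ∏ i, ((b i : ℤ) : ℝ))
  have h0 : ∑ b : S → ℤˣ, ∏ i, ((b i : ℤ) : ℝ) = 0 := by
    rw [← Fintype.prod_sum (fun (_ : S) (u : ℤˣ) => ((u : ℤ) : ℝ))]
    obtain ⟨i, hi⟩ := hne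
    refine Finset.prod_eq_zero (Finset.mem_univ ⟨i, hi⟩) ?_
    simp [UnitsInt.univ]
  rw [h0, mul_zero] at h
  have h2 : (Fintype.card ℤˣ : ℝ) ^ S.card ≠ 0 := by positivity
  rcases mul_eq_zero.1 h with h | h
  · rw [← h]
    refine Finset.sum_congr rfl fun θ _ => ?_
    exact (Finset.prod_coe_sort S fun i => ((s θ i : ℤ) : ℝ)).symm
  · exact absurd h h2

theorem sign_mul_self (u : ℤˣ) : ((u : ℤ) : ℝ) * ((u : ℤ) : ℝ) = 1 := by
  rcases Int.units_eq_one_or u with rfl | rfl <;> simp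

theorem sign_sq (u : ℤˣ) : ((u : ℤ) : ℝ) ^ 2 = 1 := by
  rw [sq, sign_mul_self]

theorem KWiseIndependent.sum_sign_mul_sign {s : Θ → Fin d → ℤˣ} (hs : KWiseIndependent 2 s)
    (i j : Fin d) :
    ∑ θ, ((s θ i : ℤ) : ℝ) * ((s θ j : ℤ) : ℝ) = if i = j then (Fintype.card Θ : ℝ) else 0 := by
  split_ifs with h
  · subst h
    simp [sign_mul_self]
  · have := hs.sum_prod_sign {i, j} Finset.card_le_two (by simp)
    simpa [Finset.prod_pair h] using this

/-- Only the two pairings of (i, j) with (k, l) survive. If exactly one index is shared, its sign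
squares to 1 and two distinct signs of mean zero remain; four distinct signs have mean zero by
four-wise independence. -/
theorem KWiseIndependent.sum_sign_four {s : Θ → Fin d → ℤˣ} (hs : KWiseIndependent 4 s)
    {i j k l : Fin d} (hij : i ≠ j) (hkl : k ≠ l) :
    ∑ θ, ((s θ i : ℤ) : ℝ) * ((s θ j : ℤ) : ℝ) * (((s θ k : ℤ) : ℝ) * ((s θ l : ℤ) : ℝ))
      = (if i = k ∧ j = l then (Fintype.card Θ : ℝ) else 0)
        + (if i = l ∧ j = k then (Fintype.card Θ : ℝ) else 0) := by
  have h2 : KWiseIndependent 2 s := hs.mono (by norm_num)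
  have red : ∀ a b e : Fin d, ∑ θ, ((s θ a : ℤ) : ℝ) * ((s θ a : ℤ) : ℝ) *
      (((s θ b : ℤ) : ℝ) * ((s θ e : ℤ) : ℝ)) = if b = e then (Fintype.card Θ : ℝ) else 0 := by
    intro a b e
    simp_rw [sign_mul_self, one_mul]
    exact h2.sum_sign_mul_sign b e
  by_cases hik : i = k
  · subst hik
    rw [← Finset.sum_congr rfl (fun θ _ => show ((s θ i : ℤ) : ℝ) * ((s θ i : ℤ) : ℝ) *
      (((s θ j : ℤ) : ℝ) * ((s θ l : ℤ) : ℝ)) = _ by ring), red]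
    simp [hij.symm]
  by_cases hil : i = l
  · subst hil
    rw [← Finset.sum_congr rfl (fun θ _ => show ((s θ i : ℤ) : ℝ) * ((s θ i : ℤ) : ℝ) *
      (((s θ j : ℤ) : ℝ) * ((s θ k : ℤ) : ℝ)) = _ by ring), red]
    simp [hij.symm]
  by_cases hjk : j = k
  · subst hjk
    rw [← Finset.sum_congr rfl (fun θ _ => show ((s θ j : ℤ) : ℝ) * ((s θ j : ℤ) : ℝ) *
      (((s θ i : ℤ) : ℝ) * ((s θ l : ℤ) : ℝ)) = _ by ring), red]
    simp [hij, hil]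
  by_cases hjl : j = l
  · subst hjl
    rw [← Finset.sum_congr rfl (fun θ _ => show ((s θ j : ℤ) : ℝ) * ((s θ j : ℤ) : ℝ) *
      (((s θ i : ℤ) : ℝ) * ((s θ k : ℤ) : ℝ)) = _ by ring), red]
    simp [hij, hik]
  have := hs.sum_prod_sign {i, j, k, l} Finset.card_le_four (by simp)
  simp only [hik, hil, false_and, if_false, add_zero]
  rw [← this]
  refine Finset.sum_congr rfl fun θ _ => ?_
  rw [Finset.prod_insert (by simp [hij, hik, hil]), Finset.prod_insert (by simp [hjk, hjl]),
    Finset.prod_pair hkl]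
  ring

theorem KWiseIndependent.sum_sq_linear {s : Θ → Fin d → ℤˣ} (hs : KWiseIndependent 2 s)
    (y : Fin d → ℝ) :
    ∑ θ, (∑ j, ((s θ j : ℤ) : ℝ) * y j) ^ 2 = Fintype.card Θ * ∑ j, y j ^ 2 := by
  have h1 : ∀ θ, (∑ j, ((s θ j : ℤ) : ℝ) * y j) ^ 2
      = ∑ i, ∑ j, y i * y j * (((s θ i : ℤ) : ℝ) * ((s θ j : ℤ) : ℝ)) := by
    intro θ
    rw [sq, Finset.sum_mul_sum]
    exact Finset.sum_congr rfl fun i _ => Finset.sum_congr rfl fun j _ => by ring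
  simp_rw [h1]
  rw [Finset.sum_comm, Finset.mul_sum]
  refine Finset.sum_congr rfl fun i _ => ?_
  rw [Finset.sum_comm]
  simp_rw [← Finset.mul_sum, hs.sum_sign_mul_sign]
  simp
  ring

/-- The two surviving pairings of `sum_sign_four` agree by symmetry, whence the factor 2. This
yields the variance of the norm estimate. -/
theorem KWiseIndependent.sum_sq_bilinear {s : Θ → Fin d → ℤˣ} (hs : KWiseIndependent 4 s)
    (a : Fin d → Fin d → ℝ) (ha : ∀ i, a i i = 0) (hsymm : ∀ i j, a i j = a j i) :
    ∑ θ, (∑ i, ∑ j, a i j * (((s θ i : ℤ) : ℝ) * ((s θ j : ℤ) : ℝ))) ^ 2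
      = 2 * Fintype.card Θ * ∑ i, ∑ j, a i j ^ 2 := by
  have h1 : ∀ θ, (∑ i, ∑ j, a i j * (((s θ i : ℤ) : ℝ) * ((s θ j : ℤ) : ℝ))) ^ 2
      = ∑ i, ∑ j, ∑ k, ∑ l, a i j * a k l *
        (((s θ i : ℤ) : ℝ) * ((s θ j : ℤ) : ℝ) * (((s θ k : ℤ) : ℝ) * ((s θ l : ℤ) : ℝ))) := by
    intro θ
    rw [sq, Finset.sum_mul]
    refine Finset.sum_congr rfl fun i _ => ?_
    rw [Finset.sum_mul]
    refine Finset.sum_congr rfl fun j _ => ?_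
    rw [Finset.mul_sum]
    refine Finset.sum_congr rfl fun k _ => ?_
    rw [Finset.mul_sum]
    refine Finset.sum_congr rfl fun l _ => ?_
    ring
  simp_rw [h1]
  rw [Finset.sum_comm, Finset.mul_sum]
  refine Finset.sum_congr rfl fun i _ => ?_
  rw [Finset.sum_comm, Finset.mul_sum]
  refine Finset.sum_congr rfl fun j _ => ?_
  rw [Finset.sum_comm]
  have h2 : ∀ k l, ∑ θ, a i j * a k l *
        (((s θ i : ℤ) : ℝ) * ((s θ j : ℤ) : ℝ) * (((s θ k : ℤ) : ℝ) * ((s θ l : ℤ) : ℝ)))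
      = a i j * a k l * ((if i = k ∧ j = l then (Fintype.card Θ : ℝ) else 0)
        + (if i = l ∧ j = k then (Fintype.card Θ : ℝ) else 0)) := by
    intro k l
    by_cases hij : i = j
    · simp [hij, ha]
    by_cases hkl : k = l
    · simp [hkl, ha]
    rw [← Finset.mul_sum, hs.sum_sign_four hij hkl]
  have h3 : ∀ k, ∑ θ, ∑ l, a i j * a k l *
        (((s θ i : ℤ) : ℝ) * ((s θ j : ℤ) : ℝ) * (((s θ k : ℤ) : ℝ) * ((s θ l : ℤ) : ℝ)))
      = ∑ l, a i j * a k l * ((if i = k ∧ j = l then (Fintype.card Θ : ℝ) else 0)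
        + (if i = l ∧ j = k then (Fintype.card Θ : ℝ) else 0)) := by
    intro k
    rw [Finset.sum_comm]
    exact Finset.sum_congr rfl fun l _ => h2 k l
  simp_rw [h3, mul_add, Finset.sum_add_distrib, ite_and]
  simp
  rw [hsymm j i]
  ring

theorem KWiseIndependent.sum_collision [Nonempty R] {h : Θ → Fin d → R}
    (hh : KWiseIndependent 2 h) {i j : Fin d} (hij : i ≠ j) :
    (∑ θ, if h θ i = h θ j then (1 : ℝ) else 0) * Fintype.card R = Fintype.card Θ := by
  have hS : ({i, j} : Finset (Fin d)).card = 2 := Finset.card_pair hij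
  have h1 : ∀ b : R, (∑ θ, if h θ i = b ∧ h θ j = b then (1 : ℝ) else 0)
      * (Fintype.card R : ℝ) ^ 2 = Fintype.card Θ := by
    intro b
    have := hh {i, j} hS.le fun _ => b
    rw [← this, hS]
    push_cast
    simp
  have h2 : ∑ θ, (if h θ i = h θ j then (1 : ℝ) else 0)
      = ∑ b, ∑ θ, if h θ i = b ∧ h θ j = b then (1 : ℝ) else 0 := by
    rw [Finset.sum_comm]
    refine Finset.sum_congr rfl fun θ _ => ?_
    simp_rw [ite_and]
    simp [eq_comm]
  have hR : (Fintype.card R : ℝ) ≠ 0 := by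
    have := Fintype.card_pos (α := R)
    positivity
  have h3 : (∑ θ, if h θ i = h θ j then (1 : ℝ) else 0) * (Fintype.card R : ℝ) ^ 2
      = Fintype.card R * Fintype.card Θ := by
    rw [h2, Finset.sum_mul, Finset.sum_congr rfl fun b _ => h1 b]
    simp
  apply mul_right_cancel₀ hR
  rw [mul_assoc, ← sq, h3, mul_comm]

end Hash

/-! ## Single rows of the sketch -/

section Row

variable {d c : ℕ}

/-- The row of counters belonging to one bucket hash and one sign hash. -/
def sketchRow (F : HashFamily d c) (p : Fin F.numBucket × Fin F.numSign)
    (x : EuclideanSpace ℝ (Fin d)) (b : Fin c) : ℝ :=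
  ∑ i with F.bucket p.1 i = b, ((F.sign p.2 i : ℤ) : ℝ) * x i

/-- The squared-norm estimate of one row. -/
def rowNormSq (F : HashFamily d c) (p : Fin F.numBucket × Fin F.numSign)
    (x : EuclideanSpace ℝ (Fin d)) : ℝ :=
  ∑ b, sketchRow F p x b ^ 2

/-- The estimate of the `i`-th coordinate from one row. -/
def rowCoord (F : HashFamily d c) (p : Fin F.numBucket × Fin F.numSign)
    (x : EuclideanSpace ℝ (Fin d)) (i : Fin d) : ℝ :=
  ((F.sign p.2 i : ℤ) : ℝ) * sketchRow F p x (F.bucket p.1 i)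

/-- The diagonal terms add up to exactly ‖x‖² because signs square to 1. The error is a quadratic
form in the signs over colliding pairs, with the zero diagonal that `sum_sq_bilinear` requires. -/
theorem rowNormSq_sub (F : HashFamily d c) (p : Fin F.numBucket × Fin F.numSign)
    (x : EuclideanSpace ℝ (Fin d)) :
    rowNormSq F p x - ‖x‖ ^ 2 = ∑ i, ∑ j,
      (if i ≠ j ∧ F.bucket p.1 i = F.bucket p.1 j then x i * x j else 0) *
        (((F.sign p.2 i : ℤ) : ℝ) * ((F.sign p.2 j : ℤ) : ℝ)) := by
  have h1 : rowNormSq F p x = ∑ i, ∑ j,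
      (if F.bucket p.1 i = F.bucket p.1 j then x i * x j else 0) *
        (((F.sign p.2 i : ℤ) : ℝ) * ((F.sign p.2 j : ℤ) : ℝ)) := by
    simp only [rowNormSq, sketchRow, Finset.sum_filter]
    simp_rw [sq, Finset.sum_mul_sum]
    rw [Finset.sum_comm]
    refine Finset.sum_congr rfl fun i _ => ?_
    rw [Finset.sum_comm]
    refine Finset.sum_congr rfl fun j _ => ?_
    simp_rw [ite_mul, zero_mul]
    simp only [Finset.sum_ite_eq, Finset.mem_univ, if_true, mul_ite, mul_zero]
    by_cases h : F.bucket p.1 i = F.bucket p.1 j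
    · simp [h]
      ring
    · simp [h, Ne.symm h]
  have h2 : ‖x‖ ^ 2 = ∑ i, ∑ j, (if i = j then x i * x j else 0) *
        (((F.sign p.2 i : ℤ) : ℝ) * ((F.sign p.2 j : ℤ) : ℝ)) := by
    rw [EuclideanSpace.real_norm_sq_eq]
    refine Finset.sum_congr rfl fun i _ => ?_
    simp [sign_mul_self, sq]
  rw [h1, h2, ← Finset.sum_sub_distrib]
  refine Finset.sum_congr rfl fun i _ => ?_
  rw [← Finset.sum_sub_distrib]
  refine Finset.sum_congr rfl fun j _ => ?_
  by_cases h : i = j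
  · simp [h]
  · simp [h]

/-- A coordinate passes through its own counter exactly, so the error is, up to the sign of `i`, a
linear form in the coordinates colliding with it. Squaring removes that sign, and pairwise
independence then suffices for the second moment. -/
theorem rowCoord_sub_sq (F : HashFamily d c) (p : Fin F.numBucket × Fin F.numSign)
    (x : EuclideanSpace ℝ (Fin d)) (i : Fin d) :
    (rowCoord F p x i - x i) ^ 2 = (∑ j, ((F.sign p.2 j : ℤ) : ℝ) *
      (if i ≠ j ∧ F.bucket p.1 i = F.bucket p.1 j then x j else 0)) ^ 2 := by
  have h1 : rowCoord F p x i - x i = ((F.sign p.2 i : ℤ) : ℝ) * ∑ j, ((F.sign p.2 j : ℤ) : ℝ) *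
      (if i ≠ j ∧ F.bucket p.1 i = F.bucket p.1 j then x j else 0) := by
    have h2 : x i = ((F.sign p.2 i : ℤ) : ℝ) * ∑ j, ((F.sign p.2 j : ℤ) : ℝ) *
        (if i = j then x j else 0) := by
      simp [← mul_assoc, sign_mul_self]
    conv_lhs => rw [h2]
    rw [rowCoord, sketchRow, Finset.sum_filter, ← mul_sub, ← Finset.sum_sub_distrib]
    congr 1
    refine Finset.sum_congr rfl fun j _ => ?_
    by_cases h : i = j
    · simp [h]
    · by_cases h' : F.bucket p.1 i = F.bucket p.1 j
      · simp [h, h']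
      · simp [h, h', Ne.symm h']
  rw [h1, mul_pow, sign_sq, one_mul]

theorem sum_collision_weighted_le (F : HashFamily d c) (hc : 0 < c) (i : Fin d) (y : Fin d → ℝ)
    (hy : ∀ j, 0 ≤ y j) :
    ∑ h, ∑ j, (if i ≠ j ∧ F.bucket h i = F.bucket h j then y j else 0)
      ≤ F.numBucket / c * ∑ j, y j := by
  have : Nonempty (Fin c) := ⟨⟨0, hc⟩⟩
  have hc' : (0 : ℝ) < c := by exact_mod_cast hc
  rw [Finset.sum_comm, Finset.mul_sum]
  refine Finset.sum_le_sum fun j _ => ?_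
  by_cases hij : i = j
  · simp only [hij, ne_eq, not_true_eq_false, false_and, if_false, Finset.sum_const_zero]
    exact mul_nonneg (by positivity) (hy j)
  · have := F.bucket_indep.sum_collision hij
    simp only [Fintype.card_fin] at this
    simp only [ne_eq, hij, not_false_eq_true, true_and]
    rw [div_eq_mul_inv, ← this, mul_assoc, mul_assoc, mul_inv_cancel_left₀ hc'.ne', Finset.sum_mul]
    simp

theorem sum_rowNormSq_sub_sq_le (F : HashFamily d c) (hc : 0 < c)
    (x : EuclideanSpace ℝ (Fin d)) :
    ∑ p, (rowNormSq F p x - ‖x‖ ^ 2) ^ 2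
      ≤ 2 * (F.numBucket * F.numSign) / c * (‖x‖ ^ 2) ^ 2 := by
  rw [Fintype.sum_prod_type]
  simp_rw [rowNormSq_sub]
  have h1 : ∀ h, ∑ s, (∑ i, ∑ j,
      (if i ≠ j ∧ F.bucket h i = F.bucket h j then x i * x j else 0) *
        (((F.sign s i : ℤ) : ℝ) * ((F.sign s j : ℤ) : ℝ))) ^ 2
      = 2 * F.numSign * ∑ i, x i ^ 2 *
        ∑ j, (if i ≠ j ∧ F.bucket h i = F.bucket h j then x j ^ 2 else 0) := by
    intro h
    rw [F.sign_indep.sum_sq_bilinear]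
    · simp only [Fintype.card_fin]
      congr 1
      refine Finset.sum_congr rfl fun i _ => ?_
      rw [Finset.mul_sum]
      refine Finset.sum_congr rfl fun j _ => ?_
      split_ifs <;> ring
    · simp
    · intro i j
      simp only [ne_comm (a := i), eq_comm (a := F.bucket h i), mul_comm (x i)]
  simp_rw [h1]
  rw [← Finset.mul_sum, Finset.sum_comm]
  simp_rw [← Finset.mul_sum]
  calc 2 * (F.numSign : ℝ) * ∑ i, x i ^ 2 * ∑ h, ∑ j,
        (if i ≠ j ∧ F.bucket h i = F.bucket h j then x j ^ 2 else 0)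
      ≤ 2 * (F.numSign : ℝ) * ∑ i, x i ^ 2 * (F.numBucket / c * ∑ j, x j ^ 2) := by
        gcongr with i
        exact sum_collision_weighted_le F hc i _ fun j => sq_nonneg _
    _ = _ := by
        rw [← Finset.sum_mul, ← EuclideanSpace.real_norm_sq_eq]
        ring

theorem sum_rowCoord_sub_sq_le (F : HashFamily d c) (hc : 0 < c)
    (x : EuclideanSpace ℝ (Fin d)) (i : Fin d) :
    ∑ p, (rowCoord F p x i - x i) ^ 2 ≤ (F.numBucket * F.numSign) / c * ‖x‖ ^ 2 := by
  rw [Fintype.sum_prod_type]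
  simp_rw [rowCoord_sub_sq]
  have h2 : KWiseIndependent 2 F.sign := F.sign_indep.mono (by norm_num)
  simp_rw [h2.sum_sq_linear]
  rw [← Finset.mul_sum]
  simp only [Fintype.card_fin, ite_pow, ne_eq, OfNat.ofNat_ne_zero, not_false_eq_true, zero_pow]
  calc (F.numSign : ℝ) * ∑ h, ∑ j,
        (if ¬ i = j ∧ F.bucket h i = F.bucket h j then x j ^ 2 else 0)
      ≤ (F.numSign : ℝ) * (F.numBucket / c * ∑ j, x j ^ 2) := by
        gcongr
        exact sum_collision_weighted_le F hc i _ fun j => sq_nonneg _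
    _ = _ := by
        rw [← EuclideanSpace.real_norm_sq_eq]
        ring

/-- Chebyshev's inequality for a uniform average. -/
theorem card_mul_le_sum {α : Type*} [Fintype α] (Z : α → ℝ) (hZ : ∀ p, 0 ≤ Z p) (a : ℝ)
    (B : Finset α) (hB : ∀ p ∈ B, a ≤ Z p) : (B.card : ℝ) * a ≤ ∑ p, Z p := by
  calc (B.card : ℝ) * a = ∑ p ∈ B, a := by simp
    _ ≤ ∑ p ∈ B, Z p := Finset.sum_le_sum hB
    _ ≤ ∑ p, Z p := Finset.sum_le_sum_of_subset_of_nonneg (Finset.subset_univ _) fun p _ _ => hZ p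

/-- Chebyshev with variance 2‖x‖⁴/c at deviation ‖x‖²/2: failure probability at most 8/c, which is
at most 1/100 for c ≥ 800. -/
theorem card_bad_rowNormSq_le (F : HashFamily d c) (hc : 800 ≤ c)
    (x : EuclideanSpace ℝ (Fin d)) (hx : x ≠ 0) :
    100 * (Finset.univ.filter fun p =>
      ¬ (rowNormSq F p x ∈ Set.Icc (‖x‖ ^ 2 / 2) (3 * ‖x‖ ^ 2 / 2))).card
        ≤ F.numBucket * F.numSign := by
  have hn : 0 < ‖x‖ ^ 2 := by positivity
  have h := card_mul_le_sum (fun p => (rowNormSq F p x - ‖x‖ ^ 2) ^ 2) (fun p => sq_nonneg _)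
    ((‖x‖ ^ 2) ^ 2 / 4) (Finset.univ.filter fun p =>
      ¬ (rowNormSq F p x ∈ Set.Icc (‖x‖ ^ 2 / 2) (3 * ‖x‖ ^ 2 / 2))) (by
      intro p hp
      simp only [Set.mem_Icc, not_and_or, not_le, Finset.mem_filter, Finset.mem_univ,
        true_and] at hp
      rcases hp with hp | hp <;> nlinarith)
  have h' := h.trans (sum_rowNormSq_sub_sq_le F (by omega) x)
  have hc' : (800 : ℝ) ≤ c := by exact_mod_cast hc
  have hle : 2 * ((F.numBucket : ℝ) * F.numSign) / c * (‖x‖ ^ 2) ^ 2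
      ≤ (F.numBucket * F.numSign) / 400 * (‖x‖ ^ 2) ^ 2 := by
    gcongr ?_ * _
    rw [div_le_div_iff₀ (by linarith) (by norm_num)]
    have : (0 : ℝ) ≤ F.numBucket * F.numSign := by positivity
    nlinarith
  have hn2 : 0 < (‖x‖ ^ 2) ^ 2 := by positivity
  have h3 := h'.trans hle
  rw [← Nat.cast_le (α := ℝ)]
  push_cast
  refine le_of_mul_le_mul_right ?_ hn2
  linarith

/-- Chebyshev with variance ‖x‖²/c at deviation ‖x‖/(5√k): failure probability at most 25k/c. This
is the origin of the constant 2500. -/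
theorem card_bad_rowCoord_le (F : HashFamily d c) {k : ℕ} (hk : 0 < k) (hc : 2500 * k ≤ c)
    (x : EuclideanSpace ℝ (Fin d)) (hx : x ≠ 0) (i : Fin d) :
    100 * (Finset.univ.filter fun p => ¬ (rowCoord F p x i ∈
      Set.Icc (x i - ‖x‖ / (5 * √k)) (x i + ‖x‖ / (5 * √k)))).card
        ≤ F.numBucket * F.numSign := by
  have hn : 0 < ‖x‖ := by positivity
  have hk' : (0 : ℝ) < k := by exact_mod_cast hk
  have h := card_mul_le_sum (fun p => (rowCoord F p x i - x i) ^ 2) (fun p => sq_nonneg _)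
    ((‖x‖ / (5 * √k)) ^ 2) (Finset.univ.filter fun p => ¬ (rowCoord F p x i ∈
      Set.Icc (x i - ‖x‖ / (5 * √k)) (x i + ‖x‖ / (5 * √k)))) (by
      intro p hp
      have hpos : 0 < ‖x‖ / (5 * √k) := by positivity
      simp only [Set.mem_Icc, not_and_or, not_le, Finset.mem_filter, Finset.mem_univ,
        true_and] at hp
      rcases hp with hp | hp <;> nlinarith)
  have h' := h.trans (sum_rowCoord_sub_sq_le F (by omega) x i)
  have hc' : (2500 : ℝ) * k ≤ c := by exact_mod_cast hc
  have e1 : (‖x‖ / (5 * √k)) ^ 2 = ‖x‖ ^ 2 / (25 * k) := by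
    rw [div_pow, mul_pow, Real.sq_sqrt hk'.le]
    norm_num
  rw [e1] at h'
  have hle : ((F.numBucket : ℝ) * F.numSign) / c * ‖x‖ ^ 2
      ≤ (F.numBucket * F.numSign) / (2500 * k) * ‖x‖ ^ 2 := by
    gcongr
  have h3 := h'.trans hle
  rw [← Nat.cast_le (α := ℝ)]
  push_cast
  have hn2 : 0 < ‖x‖ ^ 2 / (2500 * k) := by positivity
  refine le_of_mul_le_mul_right ?_ hn2
  calc _ = _ := by ring
    _ ≤ _ := h3
    _ = _ := by ring

end Row

/-! ## Medians -/

theorem card_filter_comp_perm {r : ℕ} (σ : Equiv.Perm (Fin r)) (p : Fin r → Prop)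
    [DecidablePred p] :
    (Finset.univ.filter fun i => p (σ i)).card = (Finset.univ.filter p).card := by
  refine Finset.card_bij (fun i _ => σ i) (by simp) (by simp) fun b hb => ⟨σ.symm b, ?_, by simp⟩
  simpa using hb

/-- If the lower middle order statistic were below `a`, or the upper one above `b`, at least half of
the values would lie outside the interval. -/
theorem median_mem_Icc {r : ℕ} (v : Fin r → ℝ) (a b : ℝ)
    (h : 2 * (Finset.univ.filter fun j => ¬ (v j ∈ Set.Icc a b)).card < r) :
    median v ∈ Set.Icc a b := by
  classical
  have hr : 0 < r := by omega
  have hmono := Tuple.monotone_sort v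
  have hlow : a ≤ v (Tuple.sort v ⟨(r - 1) / 2, by omega⟩) := by
    by_contra! hlt
    have h1 := (Tuple.lt_card_lt_iff_apply_lt_of_monotone (j := ⟨(r - 1) / 2, by omega⟩)
      hmono).2 hlt
    have h2 := card_filter_comp_perm (Tuple.sort v) fun i => v i < a
    simp only [Function.comp_apply] at h1
    rw [h2] at h1
    have h3 : (Finset.univ.filter fun i => v i < a).card
        ≤ (Finset.univ.filter fun j => ¬ (v j ∈ Set.Icc a b)).card := by
      refine Finset.card_le_card fun j => ?_
      simp only [Finset.mem_filter, Finset.mem_univ, true_and, Set.mem_Icc, not_and]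
      intro h4 h5
      linarith
    omega
  have hupp : v (Tuple.sort v ⟨r / 2, by omega⟩) ≤ b := by
    by_contra! hlt
    have h1 := (Tuple.lt_card_le_iff_apply_le_of_monotone (j := ⟨r / 2, by omega⟩) (a := b)
      hmono).not.2 (not_le.2 hlt)
    have h2 := card_filter_comp_perm (Tuple.sort v) fun i => v i ≤ b
    simp only [Function.comp_apply] at h1
    rw [h2] at h1
    have h3 : (Finset.univ.filter fun i => ¬ v i ≤ b).card
        ≤ (Finset.univ.filter fun j => ¬ (v j ∈ Set.Icc a b)).card := by
      refine Finset.card_le_card fun j => ?_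
      simp only [Finset.mem_filter, Finset.mem_univ, true_and, Set.mem_Icc, not_and]
      intro h4 _
      exact h4
    have h4 := Finset.card_filter_add_card_filter_not (s := (Finset.univ : Finset (Fin r)))
      fun i => v i ≤ b
    rw [Finset.card_univ, Fintype.card_fin] at h4
    omega
  have hmid : v (Tuple.sort v ⟨(r - 1) / 2, by omega⟩) ≤ v (Tuple.sort v ⟨r / 2, by omega⟩) := by
    refine hmono ?_
    rw [Fin.mk_le_mk]
    omega
  rw [median, dif_pos hr]
  constructor <;> linarith

/-- If each row is bad with probability at most `1 / 100`, then at least half of `r` independent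
rows are bad with probability at most `5⁻ʳ`. -/
theorem card_majority_le {A B : Type} [Fintype A] [Fintype B] [DecidableEq A] [DecidableEq B]
    (bad : Finset (A × B)) (h : 100 * bad.card ≤ Fintype.card A * Fintype.card B) (r : ℕ) :
    (5 : ℝ) ^ r * (Finset.univ.filter fun q : (Fin r → A) × (Fin r → B) =>
      r ≤ 2 * (Finset.univ.filter fun j => (q.1 j, q.2 j) ∈ bad).card).card
        ≤ ((Fintype.card A : ℝ) * Fintype.card B) ^ r := by
  -- A Chernoff bound with weight 100 on bad rows. The mean weight of a row is at most 1 + 99/100 ≤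
  -- 2, while bad rows numbering at least r/2 force the product to be at least 10^r; the quotient is
  -- 5^(-r).
  set φ : A → B → ℝ := fun a b => if (a, b) ∈ bad then 100 else 1 with hφ
  have hsum : ∑ q : (Fin r → A) × (Fin r → B), ∏ j, φ (q.1 j) (q.2 j)
      = (∑ a, ∑ b, φ a b) ^ r := by
    rw [Fintype.sum_prod_type]
    simp_rw [← Fintype.prod_sum]
    rw [← Fintype.prod_sum fun (_ : Fin r) a => ∑ b, φ a b]
    simp
  have hone : ∑ a, ∑ b, φ a b ≤ 2 * ((Fintype.card A : ℝ) * Fintype.card B) := by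
    rw [← Fintype.sum_prod_type']
    have : ∀ p : A × B, φ p.1 p.2 = 1 + 99 * (if p ∈ bad then (1 : ℝ) else 0) := by
      intro p
      simp only [hφ, Prod.mk.eta]
      split_ifs <;> norm_num
    simp_rw [this, Finset.sum_add_distrib, ← Finset.mul_sum]
    simp only [Finset.sum_const, Finset.card_univ, Fintype.card_prod, nsmul_eq_mul, mul_one,
      Finset.sum_ite_mem, Finset.univ_inter, Nat.cast_mul]
    have h' : (100 : ℝ) * bad.card ≤ Fintype.card A * Fintype.card B := by exact_mod_cast h
    have h0 : (0 : ℝ) ≤ bad.card := by positivity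
    linarith
  have hφ0 : ∀ a b, 0 ≤ φ a b := by
    intro a b
    simp only [hφ]
    split_ifs <;> norm_num
  have hmk := card_mul_le_sum (fun q : (Fin r → A) × (Fin r → B) => ∏ j, φ (q.1 j) (q.2 j))
    (fun q => Finset.prod_nonneg fun j _ => hφ0 _ _) (10 ^ r)
    (Finset.univ.filter fun q : (Fin r → A) × (Fin r → B) =>
      r ≤ 2 * (Finset.univ.filter fun j => (q.1 j, q.2 j) ∈ bad).card) (by
      intro q hq
      have hq := (Finset.mem_filter.1 hq).2
      simp only [hφ]
      rw [Finset.prod_ite, Finset.prod_const, Finset.prod_const_one, mul_one,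
        show (100 : ℝ) = 10 ^ 2 by norm_num, ← pow_mul]
      exact pow_le_pow_right₀ (by norm_num) hq)
  rw [hsum] at hmk
  have h2 : (∑ a, ∑ b, φ a b) ^ r ≤ (2 * ((Fintype.card A : ℝ) * Fintype.card B)) ^ r :=
    pow_le_pow_left₀ (Finset.sum_nonneg fun a _ => Finset.sum_nonneg fun b _ => hφ0 a b) hone r
  have h3 := hmk.trans h2
  rw [show (10 : ℝ) = 2 * 5 by norm_num, mul_pow, mul_pow, ← mul_assoc, mul_comm _ ((2 : ℝ) ^ r),
    mul_assoc] at h3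
  have h4 := le_of_mul_le_mul_left h3 (by positivity)
  linarith

/-! ## Random selection -/

section FirstOf

variable {d : ℕ}

theorem firstOf_subset (π : Equiv.Perm (Fin d)) (l : ℕ) (B : Finset (Fin d)) :
    firstOf π l B ⊆ B :=
  Finset.filter_subset _ _

theorem mem_firstOf {π : Equiv.Perm (Fin d)} {l : ℕ} {B : Finset (Fin d)} {i : Fin d} :
    i ∈ firstOf π l B ↔ i ∈ B ∧ (B.filter fun j => π j < π i).card < l :=
  Finset.mem_filter

theorem card_firstOf (π : Equiv.Perm (Fin d)) (l : ℕ) (B : Finset (Fin d)) :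
    (firstOf π l B).card = min l B.card := by
  -- The rank in the order `π` maps `B` bijectively onto 0, …, |B| - 1, and `firstOf` keeps the
  -- ranks below `l`.
  set rank : Fin d → ℕ := fun i => (B.filter fun j => π j < π i).card with hrank
  have hlt : ∀ i ∈ B, ∀ i', π i < π i' → rank i < rank i' := by
    intro i hi i' hii'
    refine Finset.card_lt_card ((Finset.ssubset_iff_of_subset fun j hj => ?_).2 ⟨i, ?_, ?_⟩)
    · simp only [Finset.mem_filter] at hj ⊢
      exact ⟨hj.1, hj.2.trans hii'⟩
    · simp [hi, hii']
    · simp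
  have hinj : Set.InjOn rank B := by
    intro i hi i' hi' h
    by_contra hne
    rcases lt_or_gt_of_ne (π.injective.ne hne) with h' | h'
    · exact (hlt i hi i' h').ne h
    · exact (hlt i' hi' i h').ne h.symm
  have himg : B.image rank = Finset.range B.card := by
    refine Finset.eq_of_subset_of_card_le (fun n hn => ?_) ?_
    · obtain ⟨i, hi, rfl⟩ := Finset.mem_image.1 hn
      rw [Finset.mem_range]
      refine Finset.card_lt_card ((Finset.ssubset_iff_of_subset (Finset.filter_subset _ _)).2
        ⟨i, hi, by simp⟩)
    · rw [Finset.card_range, Finset.card_image_of_injOn hinj]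
  have h1 : (firstOf π l B).card = ((firstOf π l B).image rank).card :=
    (Finset.card_image_of_injOn (hinj.mono (by exact_mod_cast firstOf_subset π l B))).symm
  have h2 : (firstOf π l B).image rank = Finset.range (min l B.card) := by
    have : (firstOf π l B).image rank = (B.image rank).filter fun n => n < l := by
      rw [Finset.filter_image]
      rfl
    rw [this, himg]
    ext n
    simp
    tauto
  rw [h1, h2, Finset.card_range]

/-- Composition with the transposition of `i` and `i'` is a bijection of the permutations exchanging
the two events. -/
theorem card_mem_firstOf_eq (l : ℕ) {B : Finset (Fin d)} {i i' : Fin d} (hi : i ∈ B)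
    (hi' : i' ∈ B) :
    (Finset.univ.filter fun π : Equiv.Perm (Fin d) => i ∈ firstOf π l B).card
      = (Finset.univ.filter fun π : Equiv.Perm (Fin d) => i' ∈ firstOf π l B).card := by
  have hmem : ∀ j, Equiv.swap i i' j ∈ B ↔ j ∈ B := by
    intro j
    by_cases h1 : j = i
    · simp [h1, hi, hi']
    by_cases h2 : j = i'
    · simp [h2, hi, hi']
    rw [Equiv.swap_apply_of_ne_of_ne h1 h2]
  have key : ∀ (π : Equiv.Perm (Fin d)), i ∈ firstOf ((Equiv.swap i i').trans π) l B ↔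
      i' ∈ firstOf π l B := by
    intro π
    rw [mem_firstOf, mem_firstOf]
    have : (B.filter fun j => ((Equiv.swap i i').trans π) j < ((Equiv.swap i i').trans π) i).card
        = (B.filter fun j => π j < π i').card := by
      refine Finset.card_bij (fun j _ => Equiv.swap i i' j) ?_ (by simp) ?_
      · intro j hj
        simpa [hmem] using hj
      · intro j hj
        exact ⟨Equiv.swap i i' j, by simpa [hmem] using hj, by simp⟩
    rw [this]
    simp only [hi, hi', true_and]
  refine Finset.card_bij (fun π _ => (Equiv.swap i i').trans π) ?_ ?_ ?_
  · intro π hπ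
    simp only [Finset.mem_filter, Finset.mem_univ, true_and] at hπ ⊢
    rw [← key]
    convert hπ using 2
    ext j
    simp
  · intro π _ π' _ h
    ext j
    have := congrArg (fun e => e (Equiv.swap i i' j)) h
    simpa using congrArg Fin.val this
  · intro π hπ
    simp only [Finset.mem_filter, Finset.mem_univ, true_and] at hπ ⊢
    refine ⟨(Equiv.swap i i').trans π, (key π).2 hπ, ?_⟩
    ext j
    simp

/-- Double counting: every permutation selects min(l, |B|) elements, and by symmetry all elements of
`B` are selected equally often. -/
theorem card_mul_card_mem_firstOf (l : ℕ) {B : Finset (Fin d)} {i : Fin d} (hi : i ∈ B) :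
    B.card * (Finset.univ.filter fun π : Equiv.Perm (Fin d) => i ∈ firstOf π l B).card
      = Fintype.card (Equiv.Perm (Fin d)) * min l B.card := by
  have h1 : ∑ j ∈ B, (Finset.univ.filter fun π : Equiv.Perm (Fin d) => j ∈ firstOf π l B).card
      = Fintype.card (Equiv.Perm (Fin d)) * min l B.card := by
    simp_rw [Finset.card_filter]
    rw [Finset.sum_comm]
    have : ∀ π : Equiv.Perm (Fin d), (∑ j ∈ B, if j ∈ firstOf π l B then 1 else 0)
        = min l B.card := by
      intro π
      rw [← card_firstOf π l B, Finset.sum_ite_mem,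
        Finset.inter_eq_right.2 (firstOf_subset π l B)]
      simp
    simp [this]
  rw [← h1, Finset.sum_congr rfl fun j hj => card_mem_firstOf_eq l hj hi]
  simp

theorem card_mul_sum_firstOf (l : ℕ) (B : Finset (Fin d)) (y : Fin d → ℝ) :
    (B.card : ℝ) * ∑ π : Equiv.Perm (Fin d), ∑ i ∈ firstOf π l B, y i
      = Fintype.card (Equiv.Perm (Fin d)) * (min l B.card : ℕ) * ∑ i ∈ B, y i := by
  have h1 : ∀ π : Equiv.Perm (Fin d), ∑ i ∈ firstOf π l B, y i
      = ∑ i ∈ B, if i ∈ firstOf π l B then y i else 0 := by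
    intro π
    rw [Finset.sum_ite_mem, Finset.inter_eq_right.2 (firstOf_subset π l B)]
  simp_rw [h1]
  rw [Finset.sum_comm, Finset.mul_sum, Finset.mul_sum]
  refine Finset.sum_congr rfl fun i hi => ?_
  have h2 := card_mul_card_mem_firstOf l hi
  rw [← Finset.sum_filter, Finset.sum_const, nsmul_eq_mul, ← mul_assoc]
  rw [← Nat.cast_mul, h2]
  push_cast
  ring

theorem card_heavyMix_le {c r : ℕ} (F : HashFamily d c) (θ : Seed F r) (k : ℕ)
    (S : Fin r → Fin c → ℝ) : (heavyMix F θ k S).card ≤ k := by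
  refine (Finset.card_union_le _ _).trans ?_
  rw [card_firstOf, card_firstOf]
  omega

/-- If every coordinate in `H` carries at least a fraction `1 / (4 k)` of the squared norm, then
filling up or thinning out `H` to `k` elements captures a fraction `k / (8 d)` on average. -/
theorem le_sum_firstOf_union {k : ℕ} (hk : 0 < k) (hkd : k ≤ d) (H : Finset (Fin d))
    (y : Fin d → ℝ) (hy : ∀ i, 0 ≤ y i) (hH : ∀ i ∈ H, ∑ j, y j ≤ 4 * k * y i) :
    Fintype.card (Equiv.Perm (Fin d)) * (k / (8 * d) * ∑ j, y j)
      ≤ ∑ π : Equiv.Perm (Fin d), ∑ i ∈ firstOf π k H ∪ firstOf π (k - H.card) Hᶜ, y i := by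
  have hk' : (0 : ℝ) < k := by exact_mod_cast hk
  have hkd' : (k : ℝ) ≤ d := by exact_mod_cast hkd
  have hd' : (0 : ℝ) < d := hk'.trans_le hkd'
  have hn : 0 ≤ ∑ j, y j := Finset.sum_nonneg fun j _ => hy j
  have hfrac : (k : ℝ) / (8 * d) ≤ 1 / 8 := by
    rw [div_le_div_iff₀ (by positivity) (by norm_num)]
    linarith
  -- With at least k/2 heavy coordinates, those kept carry (k/2) · 1/(4k) = 1/8 of the total, and k
  -- ≤ d. Otherwise all of `H` is kept, and more than k/2 random slots capture on average at least a
  -- share k/(2d) of the complement.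
  by_cases hcase : k ≤ 2 * H.card
  · rw [← nsmul_eq_mul, ← Finset.card_univ]
    refine Finset.card_nsmul_le_sum _ _ _ fun π _ => ?_
    have h1 : ∑ i ∈ firstOf π k H, y i
        ≤ ∑ i ∈ firstOf π k H ∪ firstOf π (k - H.card) Hᶜ, y i :=
      Finset.sum_le_sum_of_subset_of_nonneg Finset.subset_union_left fun i _ _ => hy i
    refine le_trans ?_ h1
    have h2 : (firstOf π k H).card • ((∑ j, y j) / (4 * k)) ≤ ∑ i ∈ firstOf π k H, y i := by
      refine Finset.card_nsmul_le_sum _ _ _ fun i hi => ?_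
      rw [div_le_iff₀ (by positivity)]
      linarith [hH i (firstOf_subset _ _ _ hi)]
    refine le_trans ?_ h2
    rw [nsmul_eq_mul, card_firstOf]
    have h3 : k ≤ 2 * min k H.card := by omega
    have h3' : (k : ℝ) / 2 ≤ (min k H.card : ℕ) := by
      have : (k : ℝ) ≤ 2 * (min k H.card : ℕ) := by exact_mod_cast h3
      linarith
    calc (k : ℝ) / (8 * d) * ∑ j, y j ≤ 1 / 8 * ∑ j, y j := by gcongr
      _ = k / 2 * ((∑ j, y j) / (4 * k)) := by field_simp; ring
      _ ≤ _ := by gcongr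
  · push Not at hcase
    have hHk : H.card ≤ k := by omega
    have hfull : ∀ π : Equiv.Perm (Fin d), firstOf π k H = H := fun π =>
      Finset.eq_of_subset_of_card_le (firstOf_subset _ _ _) (by rw [card_firstOf]; simp [hHk])
    have hsplit : ∀ π : Equiv.Perm (Fin d),
        ∑ i ∈ firstOf π k H ∪ firstOf π (k - H.card) Hᶜ, y i
          = ∑ i ∈ H, y i + ∑ i ∈ firstOf π (k - H.card) Hᶜ, y i := by
      intro π
      rw [hfull, Finset.sum_union]
      exact Disjoint.mono_right (firstOf_subset _ _ _) disjoint_compl_right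
    simp_rw [hsplit]
    rw [Finset.sum_add_distrib, Finset.sum_const, Finset.card_univ, nsmul_eq_mul]
    have h1 := card_mul_sum_firstOf (k - H.card) Hᶜ y
    have hcc : Hᶜ.card = d - H.card := by rw [Finset.card_compl, Fintype.card_fin]
    have hmin : min (k - H.card) Hᶜ.card = k - H.card := by omega
    rw [hmin] at h1
    set P : ℝ := ((Fintype.card (Equiv.Perm (Fin d)) : ℕ) : ℝ)
    have hP : 0 ≤ P := Nat.cast_nonneg _
    set X := ∑ π : Equiv.Perm (Fin d), ∑ i ∈ firstOf π (k - H.card) Hᶜ, y i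
    have hX : 0 ≤ X := Finset.sum_nonneg fun π _ => Finset.sum_nonneg fun i _ => hy i
    have hHs : 0 ≤ ∑ i ∈ H, y i := Finset.sum_nonneg fun i _ => hy i
    have hCs : 0 ≤ ∑ i ∈ Hᶜ, y i := Finset.sum_nonneg fun i _ => hy i
    have hcd : (Hᶜ.card : ℝ) ≤ d := by
      exact_mod_cast (by omega : Hᶜ.card ≤ d)
    have hkh : (k : ℝ) / 2 ≤ (k - H.card : ℕ) := by
      have : k ≤ 2 * (k - H.card) := by omega
      have : (k : ℝ) ≤ 2 * (k - H.card : ℕ) := by exact_mod_cast this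
      linarith
    have h2 : P * (k / (2 * d)) * ∑ i ∈ Hᶜ, y i ≤ X := by
      have : P * (k / 2) * ∑ i ∈ Hᶜ, y i ≤ d * X := by
        calc _ ≤ P * (k - H.card : ℕ) * ∑ i ∈ Hᶜ, y i := by gcongr
          _ = _ := h1.symm
          _ ≤ _ := by gcongr
      rw [show P * (k / (2 * d)) * ∑ i ∈ Hᶜ, y i = (P * (k / 2) * ∑ i ∈ Hᶜ, y i) / d by
        field_simp, div_le_iff₀ hd']
      linarith
    have h3 : ∑ j, y j = ∑ i ∈ H, y i + ∑ i ∈ Hᶜ, y i := (Finset.sum_add_sum_compl H y).symm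
    have h4 : P * (k / (8 * d)) * ∑ i ∈ Hᶜ, y i ≤ P * (k / (2 * d)) * ∑ i ∈ Hᶜ, y i := by
      gcongr
      norm_num
    have h5 : P * (k / (8 * d) * ∑ i ∈ H, y i) ≤ P * (1 * ∑ i ∈ H, y i) := by
      gcongr
      linarith
    rw [h3]
    linarith

end FirstOf

/-! ## HeavyMix captures a fraction of the squared norm -/

section HeavyMix

variable {d c r : ℕ}

/-- With a = ‖x‖/√k, a heavy estimate has absolute value at least a/√2 > 7a/10, and an error of at
most a/5 leaves |x i| ≥ a/2. -/
theorem sq_le_of_mem_heavy {F : HashFamily d c} {θ : Seed F r} {k : ℕ} (hk : 0 < k)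
    {x : EuclideanSpace ℝ (Fin d)}
    (hnorm : ‖x‖ ^ 2 / 2 ≤ normSqEstimate (countSketch F θ x))
    {i : Fin d}
    (hcoord : coordEstimate F θ (countSketch F θ x) i ∈
      Set.Icc (x i - ‖x‖ / (5 * √k)) (x i + ‖x‖ / (5 * √k)))
    (hi : i ∈ heavy F θ k (countSketch F θ x)) : ‖x‖ ^ 2 ≤ 4 * k * x i ^ 2 := by
  have hk' : (0 : ℝ) < k := by exact_mod_cast hk
  set u := coordEstimate F θ (countSketch F θ x) i
  have hi' : normSqEstimate (countSketch F θ x) / k ≤ u ^ 2 := by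
    simpa [heavy] using hi
  have hu : ‖x‖ ^ 2 / 2 / k ≤ u ^ 2 := le_trans (by gcongr) hi'
  set a := ‖x‖ / √k with ha
  have ha2 : a ^ 2 = ‖x‖ ^ 2 / k := by rw [ha, div_pow, Real.sq_sqrt hk'.le]
  have ha0 : 0 ≤ a := by positivity
  have h5 : ‖x‖ / (5 * √k) = a / 5 := by rw [ha]; field_simp
  rw [h5, Set.mem_Icc] at hcoord
  have hu' : a ^ 2 / 2 ≤ u ^ 2 := by
    rw [ha2]
    calc _ = ‖x‖ ^ 2 / 2 / k := by ring
      _ ≤ _ := hu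
  have hu7 : 7 / 10 * a ≤ |u| := by
    refine abs_le_of_sq_le_sq' ?_ (abs_nonneg u) |>.2
    rw [sq_abs]
    nlinarith
  have hx : a / 2 ≤ |x i| := by
    have : |u| - |x i| ≤ |u - x i| := abs_sub_abs_le_abs_sub _ _
    have h2 : |u - x i| ≤ a / 5 := abs_le.2 ⟨by linarith [hcoord.1], by linarith [hcoord.2]⟩
    linarith
  have hx2 : (a / 2) ^ 2 ≤ x i ^ 2 := by
    rw [← sq_abs (x i)]
    gcongr
  rw [div_pow, ha2, div_div, div_le_iff₀ (by positivity)] at hx2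
  linarith

/-- The hash functions for which the norm and all coordinates are well estimated. -/
theorem card_good_seeds (F : HashFamily d c) {k : ℕ} (hk : 0 < k) (hc : 2500 * k ≤ c)
    (hr : 2 * ((d : ℝ) + 1) ≤ 5 ^ r) (x : EuclideanSpace ℝ (Fin d)) (hx : x ≠ 0) :
    ((F.numBucket : ℝ) * F.numSign) ^ r ≤ 2 * (Finset.univ.filter fun
      q : (Fin r → Fin F.numBucket) × (Fin r → Fin F.numSign) =>
        ∀ π, ‖x‖ ^ 2 / 2 ≤ normSqEstimate (countSketch F (q.1, q.2, π) x) ∧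
          ∀ i, coordEstimate F (q.1, q.2, π) (countSketch F (q.1, q.2, π) x) i ∈
            Set.Icc (x i - ‖x‖ / (5 * √k)) (x i + ‖x‖ / (5 * √k))).card := by
  classical
  set N : ℝ := (F.numBucket : ℝ) * F.numSign with hN
  set badN := Finset.univ.filter fun p : Fin F.numBucket × Fin F.numSign =>
      ¬ (rowNormSq F p x ∈ Set.Icc (‖x‖ ^ 2 / 2) (3 * ‖x‖ ^ 2 / 2)) with hbadN
  set badC : Fin d → Finset (Fin F.numBucket × Fin F.numSign) := fun i =>
    Finset.univ.filter fun p => ¬ (rowCoord F p x i ∈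
      Set.Icc (x i - ‖x‖ / (5 * √k)) (x i + ‖x‖ / (5 * √k))) with hbadC
  set maj : Finset (Fin F.numBucket × Fin F.numSign) →
      Finset ((Fin r → Fin F.numBucket) × (Fin r → Fin F.numSign)) := fun bad =>
    Finset.univ.filter fun q => r ≤ 2 * (Finset.univ.filter fun j => (q.1 j, q.2 j) ∈ bad).card
    with hmaj
  set good := Finset.univ.filter fun
      q : (Fin r → Fin F.numBucket) × (Fin r → Fin F.numSign) =>
        ∀ π, ‖x‖ ^ 2 / 2 ≤ normSqEstimate (countSketch F (q.1, q.2, π) x) ∧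
          ∀ i, coordEstimate F (q.1, q.2, π) (countSketch F (q.1, q.2, π) x) i ∈
            Set.Icc (x i - ‖x‖ / (5 * √k)) (x i + ‖x‖ / (5 * √k)) with hgood
  -- A median fails only if at least half of its rows are bad, so d + 1 majority events cover the
  -- bad hash functions. The ordering `π` does not enter the estimates.
  have hcover : (Finset.univ : Finset ((Fin r → Fin F.numBucket) × (Fin r → Fin F.numSign)))
      ⊆ good ∪ (maj badN ∪ Finset.univ.biUnion fun i => maj (badC i)) := by
    intro q _
    by_contra hq
    simp only [Finset.mem_union, Finset.mem_biUnion, Finset.mem_univ, true_and, not_or,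
      not_exists] at hq
    obtain ⟨hq1, hq2, hq3⟩ := hq
    refine hq1 (Finset.mem_filter.2 ⟨Finset.mem_univ _, fun π => ⟨?_, fun i => ?_⟩⟩)
    · refine (median_mem_Icc (fun j => rowNormSq F (q.1 j, q.2 j) x)
        (‖x‖ ^ 2 / 2) (3 * ‖x‖ ^ 2 / 2) ?_).1
      simpa [hmaj, hbadN] using hq2
    · refine median_mem_Icc (fun j => rowCoord F (q.1 j, q.2 j) x i) _ _ ?_
      simpa [hmaj, hbadC] using hq3 i
  have hmajle : ∀ bad : Finset (Fin F.numBucket × Fin F.numSign),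
      100 * bad.card ≤ F.numBucket * F.numSign → (5 : ℝ) ^ r * (maj bad).card ≤ N ^ r := by
    intro bad hbad
    have := card_majority_le bad (by simpa using hbad) r
    simpa only [Fintype.card_fin] using this
  have hcount : N ^ r ≤ good.card + ((maj badN).card + ∑ i, ((maj (badC i)).card : ℝ)) := by
    have h1 := (Finset.card_le_card hcover).trans (Finset.card_union_le _ _)
    have h2 := h1.trans (add_le_add_right ((Finset.card_union_le _ _).trans
      (add_le_add_right Finset.card_biUnion_le _)) _)
    have h3 : (Finset.univ : Finset ((Fin r → Fin F.numBucket) × (Fin r → Fin F.numSign))).card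
        = (F.numBucket * F.numSign) ^ r := by
      rw [Finset.card_univ]
      simp [mul_pow]
    rw [h3] at h2
    rw [hN]
    exact_mod_cast h2
  have hNpos : 0 ≤ N ^ r := by positivity
  have h5 : (0 : ℝ) < 5 ^ r := by positivity
  have hbadle : 5 ^ r * ((maj badN).card + ∑ i, ((maj (badC i)).card : ℝ)) ≤ (d + 1) * N ^ r := by
    rw [mul_add, Finset.mul_sum]
    have h1 := hmajle badN (card_bad_rowNormSq_le F (by omega) x hx)
    have h2 : ∑ i, (5 : ℝ) ^ r * ((maj (badC i)).card : ℝ) ≤ ∑ _i : Fin d, N ^ r :=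
      Finset.sum_le_sum fun i _ => hmajle _ (card_bad_rowCoord_le F hk hc x hx i)
    simp only [Finset.sum_const, Finset.card_univ, Fintype.card_fin, nsmul_eq_mul] at h2
    linarith
  have hhalf : 2 * ((maj badN).card + ∑ i, ((maj (badC i)).card : ℝ)) ≤ N ^ r := by
    refine le_of_mul_le_mul_left ?_ h5
    calc _ = 2 * (5 ^ r * ((maj badN).card + ∑ i, ((maj (badC i)).card : ℝ))) := by ring
      _ ≤ 2 * ((d + 1) * N ^ r) := by linarith
      _ = 2 * (d + 1) * N ^ r := by ring
      _ ≤ _ := by gcongr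
  linarith

theorem restrict_zero (I : Finset (Fin d)) : restrict I (0 : EuclideanSpace ℝ (Fin d)) = 0 := by
  ext i
  simp [restrict]

theorem norm_sub_restrict_sq (I : Finset (Fin d)) (x : EuclideanSpace ℝ (Fin d)) :
    ‖x - restrict I x‖ ^ 2 = ‖x‖ ^ 2 - ∑ i ∈ I, x i ^ 2 := by
  rw [EuclideanSpace.real_norm_sq_eq, EuclideanSpace.real_norm_sq_eq,
    ← Finset.univ_inter I, ← Finset.sum_ite_mem, ← Finset.sum_sub_distrib]
  refine Finset.sum_congr rfl fun i _ => ?_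
  by_cases h : i ∈ I <;> simp [restrict, h]

theorem norm_restrict_le (I : Finset (Fin d)) (x : EuclideanSpace ℝ (Fin d)) :
    ‖restrict I x‖ ≤ ‖x‖ := by
  refine le_of_sq_le_sq ?_ (norm_nonneg _)
  rw [EuclideanSpace.real_norm_sq_eq, EuclideanSpace.real_norm_sq_eq]
  refine Finset.sum_le_sum fun i _ => ?_
  by_cases h : i ∈ I <;> simp [restrict, h, sq_nonneg]

/-- HeavyMix is a contraction on average. -/
theorem sum_norm_sub_restrict_heavyMix_le (F : HashFamily d c) {k : ℕ} (hk : 0 < k)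
    (hkd : k ≤ d) (hc : 2500 * k ≤ c) (hr : 2 * ((d : ℝ) + 1) ≤ 5 ^ r)
    (x : EuclideanSpace ℝ (Fin d)) :
    ∑ θ : Seed F r, ‖x - restrict (heavyMix F θ k (countSketch F θ x)) x‖ ^ 2
      ≤ Fintype.card (Seed F r) * ((1 - k / (16 * d)) * ‖x‖ ^ 2) := by
  classical
  by_cases hx : x = 0
  · subst hx
    simp [restrict_zero]
  simp_rw [norm_sub_restrict_sq]
  rw [Finset.sum_sub_distrib, Finset.sum_const, Finset.card_univ, nsmul_eq_mul]
  set P : ℝ := ((Fintype.card (Equiv.Perm (Fin d)) : ℕ) : ℝ) with hP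
  have hP0 : 0 ≤ P := by positivity
  have hcard : (Fintype.card (Seed F r) : ℝ) = ((F.numBucket : ℝ) * F.numSign) ^ r * P := by
    simp [hP, mul_pow, mul_assoc]
  have hgood := card_good_seeds F hk hc hr x hx
  set good := Finset.univ.filter fun
      q : (Fin r → Fin F.numBucket) × (Fin r → Fin F.numSign) =>
        ∀ π, ‖x‖ ^ 2 / 2 ≤ normSqEstimate (countSketch F (q.1, q.2, π) x) ∧
          ∀ i, coordEstimate F (q.1, q.2, π) (countSketch F (q.1, q.2, π) x) i ∈
            Set.Icc (x i - ‖x‖ / (5 * √k)) (x i + ‖x‖ / (5 * √k)) with hgooddef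
  have hcap : good.card • (P * (k / (8 * d) * ‖x‖ ^ 2))
      ≤ ∑ θ : Seed F r, ∑ i ∈ heavyMix F θ k (countSketch F θ x), x i ^ 2 := by
    have e : ∑ θ : Seed F r, ∑ i ∈ heavyMix F θ k (countSketch F θ x), x i ^ 2
        = ∑ q : (Fin r → Fin F.numBucket) × (Fin r → Fin F.numSign),
          ∑ π, ∑ i ∈ heavyMix F (q.1, q.2, π) k (countSketch F (q.1, q.2, π) x), x i ^ 2 := by
      rw [Fintype.sum_prod_type, Fintype.sum_prod_type]
      refine Finset.sum_congr rfl fun f _ => ?_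
      rw [Fintype.sum_prod_type]
    rw [e]
    refine le_trans (Finset.card_nsmul_le_sum good _ _ fun q hq => ?_)
      (Finset.sum_le_sum_of_subset_of_nonneg (Finset.subset_univ good) fun q _ _ =>
        Finset.sum_nonneg fun π _ => Finset.sum_nonneg fun i _ => sq_nonneg _)
    have hq := (Finset.mem_filter.1 hq).2
    -- The heavy set does not depend on the ordering, so the identity permutation can stand for all
    -- of them.
    have h1 := le_sum_firstOf_union hk hkd
      (heavy F (q.1, q.2, 1) k (countSketch F (q.1, q.2, 1) x)) (fun i => x i ^ 2)
      (fun i => sq_nonneg _) (fun i hi => by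
        rw [← EuclideanSpace.real_norm_sq_eq]
        exact sq_le_of_mem_heavy hk (hq 1).1 ((hq 1).2 i) hi)
    rw [← EuclideanSpace.real_norm_sq_eq] at h1
    exact h1
  rw [nsmul_eq_mul] at hcap
  -- Good hash functions make up at least half of all; the others are counted as capturing nothing.
  -- Hence k/(8d) becomes k/(16d).
  have h2 : ((F.numBucket : ℝ) * F.numSign) ^ r * (P * (k / (8 * d) * ‖x‖ ^ 2))
      ≤ 2 * good.card * (P * (k / (8 * d) * ‖x‖ ^ 2)) := by gcongr
  have h3 : ((F.numBucket : ℝ) * F.numSign) ^ r * P * (k / (16 * d) * ‖x‖ ^ 2)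
      = ((F.numBucket : ℝ) * F.numSign) ^ r * (P * (k / (8 * d) * ‖x‖ ^ 2)) / 2 := by
    ring
  rw [hcard]
  linarith

theorem average_countSketch {W : ℕ} (F : HashFamily d c) (θ : Seed F r)
    (x : Fin W → EuclideanSpace ℝ (Fin d)) :
    (average fun i => countSketch F θ (x i)) = countSketch F θ (average x) := by
  ext j b
  simp only [average, countSketch, Pi.smul_apply, Finset.sum_apply, smul_eq_mul,
    PiLp.smul_apply, WithLp.ofLp_sum, Finset.mul_sum]
  rw [Finset.sum_comm]
  refine Finset.sum_congr rfl fun i _ => ?_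
  refine Finset.sum_congr rfl fun i' _ => ?_
  ring

theorem selected_eq {W : ℕ} (F : HashFamily d c) (k : ℕ) (θ : Seed F r) (η : ℝ)
    (g : Fin W → EuclideanSpace ℝ (Fin d)) (s : State d W) :
    selected F k θ η g s = heavyMix F θ k (countSketch F θ (average (corrected η g s))) := by
  rw [selected, average_countSketch]

end HeavyMix

/-! ## The averaged dynamics -/

section Dynamics

variable {d c r W : ℕ}

/-- The restriction of `x` to the coordinates that HeavyMix selects from its sketch. -/
noncomputable def compress (F : HashFamily d c) (k : ℕ) (θ : Seed F r)
    (x : EuclideanSpace ℝ (Fin d)) : EuclideanSpace ℝ (Fin d) :=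
  restrict (heavyMix F θ k (countSketch F θ x)) x

theorem norm_compress_le (F : HashFamily d c) (k : ℕ) (θ : Seed F r)
    (x : EuclideanSpace ℝ (Fin d)) : ‖compress F k θ x‖ ≤ ‖x‖ :=
  norm_restrict_le _ _

theorem norm_sub_compress_le (F : HashFamily d c) (k : ℕ) (θ : Seed F r)
    (x : EuclideanSpace ℝ (Fin d)) : ‖x - compress F k θ x‖ ≤ ‖x‖ := by
  refine le_of_sq_le_sq ?_ (norm_nonneg _)
  rw [compress, norm_sub_restrict_sq]
  have : 0 ≤ ∑ i ∈ heavyMix F θ k (countSketch F θ x), x i ^ 2 :=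
    Finset.sum_nonneg fun i _ => sq_nonneg _
  linarith

theorem average_corrected (η : ℝ) (g : Fin W → EuclideanSpace ℝ (Fin d)) (s : State d W) :
    average (corrected η g s) = η • average g + average s.err := by
  simp only [average, corrected, Finset.sum_add_distrib, ← Finset.smul_sum, smul_add]
  rw [smul_comm]

theorem update_eq_compress (F : HashFamily d c) (k : ℕ) (θ : Seed F r) (η : ℝ)
    (g : Fin W → EuclideanSpace ℝ (Fin d)) (s : State d W) :
    update F k θ η g s = compress F k θ (η • average g + average s.err) := by
  rw [update, selected_eq, compress, average_corrected]

/-- All workers subtract the same update, so the mean error evolves like the error vector of a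
single worker. -/
theorem average_step_err (hW : 0 < W) (F : HashFamily d c) (k : ℕ) (θ : Seed F r) (η : ℝ)
    (g : Fin W → EuclideanSpace ℝ (Fin d)) (s : State d W) :
    average (step F k θ η g s).err = (η • average g + average s.err)
      - compress F k θ (η • average g + average s.err) := by
  have hW' : (W : ℝ) ≠ 0 := by positivity
  rw [← update_eq_compress, ← average_corrected]
  simp only [step, average, Finset.sum_sub_distrib, smul_sub, Finset.sum_const,
    Finset.card_univ, Fintype.card_fin]
  rw [← Nat.cast_smul_eq_nsmul ℝ, smul_smul, one_div_mul_cancel hW', one_smul]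

theorem average_zero : average (fun _ : Fin W => (0 : EuclideanSpace ℝ (Fin d))) = 0 := by
  simp [average]

end Dynamics

/-! ## Measurability -/

section Measurability

variable {d c r : ℕ}

/-- For expressions whose discrete ingredient (sorting permutation, selected set, seed) itself
depends on the point: split over its countably many values. -/
theorem measurable_select {X Y ι : Type*} [Countable ι] {mX : MeasurableSpace X}
    [MeasurableSpace Y] {f : X → ι} (hf : Measurable[mX, ⊤] f) {G : ι → X → Y}
    (hG : ∀ i, Measurable (G i)) : Measurable fun x => G (f x) x := by
  intro s hs
  have : (fun x => G (f x) x) ⁻¹' s = ⋃ i, f ⁻¹' {i} ∩ G i ⁻¹' s := by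
    ext x
    simp
  rw [this]
  exact MeasurableSet.iUnion fun i =>
    (hf (MeasurableSpace.measurableSet_top (s := {i}))).inter (hG i hs)

theorem measurable_sort (r : ℕ) :
    Measurable[_, ⊤] (Tuple.sort : (Fin r → ℝ) → Equiv.Perm (Fin r)) := by
  let _ : MeasurableSpace (Equiv.Perm (Fin r)) := ⊤
  refine measurable_to_countable' fun σ => ?_
  -- The sorting permutation is characterized by finitely many comparisons of coordinates, including
  -- the rule for ties.
  have : (Tuple.sort : (Fin r → ℝ) → Equiv.Perm (Fin r)) ⁻¹' {σ}
      = {v | ∀ i j, (i ≤ j → v (σ i) ≤ v (σ j)) ∧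
          (i < j → v (σ i) = v (σ j) → σ i < σ j)} := by
    ext v
    simp only [Set.mem_preimage, Set.mem_singleton_iff, Set.mem_ofPred_eq]
    rw [eq_comm, Tuple.eq_sort_iff]
    exact ⟨fun h i j => ⟨fun hij => h.1 hij, h.2 i j⟩,
      fun h => ⟨fun i j => (h i j).1, fun i j => (h i j).2⟩⟩
  rw [this]
  have e : ∀ i j, MeasurableSet {v : Fin r → ℝ | v (σ i) = v (σ j)} := fun i j =>
    measurableSet_eq_fun (measurable_pi_apply _) (measurable_pi_apply _)
  have l : ∀ i j, MeasurableSet {v : Fin r → ℝ | v (σ i) ≤ v (σ j)} := fun i j =>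
    measurableSet_le (measurable_pi_apply _) (measurable_pi_apply _)
  exact measurableSet_setOfPred.2 (Measurable.forall fun i => Measurable.forall fun j =>
    ((measurable_const.imp (measurableSet_setOfPred.1 (l i j))).and
      (measurable_const.imp ((measurableSet_setOfPred.1 (e i j)).imp measurable_const))))

theorem measurable_median : Measurable (median : (Fin r → ℝ) → ℝ) := by
  unfold median
  split_ifs with h
  · have : ∀ m : Fin r, Measurable fun v : Fin r → ℝ => v (Tuple.sort v m) := fun m =>
      measurable_select (measurable_sort r) (G := fun σ v => v (σ m))
        fun σ => measurable_pi_apply (σ m)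
    exact ((this _).add (this _)).div_const 2
  · exact measurable_const

theorem measurable_countSketch (F : HashFamily d c) (θ : Seed F r) :
    Measurable fun x => countSketch F θ x := by
  unfold countSketch
  fun_prop

theorem measurable_heavyMix (F : HashFamily d c) (k : ℕ) (θ : Seed F r) :
    Measurable[_, ⊤] fun x => heavyMix F θ k (countSketch F θ x) := by
  let _ : MeasurableSpace (Finset (Fin d)) := ⊤
  have hS := measurable_countSketch F θ
  have hS' : ∀ j b, Measurable fun x => countSketch F θ x j b := fun j b =>
    (measurable_pi_apply b).comp ((measurable_pi_apply j).comp hS)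
  have hnorm : Measurable fun x => normSqEstimate (countSketch F θ x) :=
    measurable_median.comp (measurable_pi_lambda _ fun j =>
      Finset.measurable_sum _ fun b _ => (hS' j b).pow_const 2)
  have hcoord : ∀ i, Measurable fun x => coordEstimate F θ (countSketch F θ x) i := fun i =>
    measurable_median.comp (measurable_pi_lambda _ fun j => (hS' j _).const_mul _)
  have hheavy : Measurable fun x => heavy F θ k (countSketch F θ x) := by
    refine measurable_to_countable' fun H => ?_
    have : (fun x => heavy F θ k (countSketch F θ x)) ⁻¹' {H}
        = {x | ∀ i, normSqEstimate (countSketch F θ x) / k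
            ≤ coordEstimate F θ (countSketch F θ x) i ^ 2 ↔ i ∈ H} := by
      ext x
      simp [heavy, Finset.ext_iff]
    rw [this]
    refine measurableSet_setOfPred.2 (Measurable.forall fun i => ?_)
    exact (measurableSet_setOfPred.1 (measurableSet_le (hnorm.div_const _)
      ((hcoord i).pow_const 2))).iff measurable_const
  exact (measurable_from_top (f := fun H : Finset (Fin d) =>
    firstOf θ.2.2 k H ∪ firstOf θ.2.2 (k - H.card) Hᶜ)).comp hheavy

theorem measurable_compress (F : HashFamily d c) (k : ℕ) (θ : Seed F r) :
    Measurable (compress F k θ) := by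
  refine measurable_select (measurable_heavyMix F k θ) (G := fun I x => restrict I x) fun I => ?_
  refine (WithLp.measurable_toLp 2 _).comp (measurable_pi_lambda _ fun i => ?_)
  by_cases h : i ∈ I
  · simp only [h, if_true]
    fun_prop
  · simp only [h, if_false]
    fun_prop

end Measurability

/-! ## Contraction in expectation -/

section Contraction

variable {d c r : ℕ} {Ω : Type*} {m0 : MeasurableSpace Ω}

/-- Split by the value of `q`: the event q = i is independent of `X` and has probability 1/|ι|. This
transfers bounds averaged over seeds for a fixed vector to random vectors. -/
theorem integral_uniform_indep {ι E : Type*} [Fintype ι] [MeasurableSpace E]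
    (P : Measure Ω) [IsProbabilityMeasure P] {m : MeasurableSpace Ω} {X : Ω → E}
    (hX : Measurable[m] X) {q : Ω → ι} (hq : Measurable[m0, ⊤] q)
    (hunif : ∀ i, P (q ⁻¹' {i}) = (Fintype.card ι : ENNReal)⁻¹)
    (hind : Indep (MeasurableSpace.comap q ⊤) m P) {φ : ι → E → ℝ}
    (hφ : ∀ i, Measurable (φ i)) (hint : ∀ i, Integrable (fun ω => φ i (X ω)) P) :
    Fintype.card ι * ∫ ω, φ (q ω) (X ω) ∂P = ∑ i, ∫ ω, φ i (X ω) ∂P := by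
  classical
  have hqi : ∀ i, MeasurableSet[m0] (q ⁻¹' {i}) := fun i =>
    hq (MeasurableSpace.measurableSet_top (s := {i}))
  have hsum : (fun ω => φ (q ω) (X ω))
      = fun ω => ∑ i, (q ⁻¹' {i}).indicator (fun _ => (1 : ℝ)) ω * φ i (X ω) := by
    ext ω
    rw [Finset.sum_eq_single (q ω)]
    · simp
    · intro i _ hi
      simp [Set.indicator, Ne.symm hi]
    · simp
  have hint' : ∀ i, Integrable
      (fun ω => (q ⁻¹' {i}).indicator (fun _ => (1 : ℝ)) ω * φ i (X ω)) P := by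
    intro i
    have : (fun ω => (q ⁻¹' {i}).indicator (fun _ => (1 : ℝ)) ω * φ i (X ω))
        = (q ⁻¹' {i}).indicator fun ω => φ i (X ω) := by
      ext ω
      by_cases h : ω ∈ q ⁻¹' {i} <;> simp [Set.indicator, h]
    rw [this]
    exact (hint i).indicator (hqi i)
  rw [hsum, integral_finsetSum _ fun i _ => hint' i, Finset.mul_sum]
  refine Finset.sum_congr rfl fun i _ => ?_
  have : Nonempty ι := ⟨i⟩
  have hindep : IndepFun ((q ⁻¹' {i}).indicator fun _ => (1 : ℝ)) (fun ω => φ i (X ω)) P := by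
    refine indep_of_indep_of_le_left (indep_of_indep_of_le_right hind ?_) ?_
    · exact Measurable.comap_le ((hφ i).comp hX)
    · refine Measurable.comap_le (Measurable.indicator measurable_const ?_)
      exact ⟨{i}, trivial, rfl⟩
  rw [hindep.integral_fun_mul_eq_mul_integral
    ((measurable_const.indicator (hqi i)).aestronglyMeasurable) (hint i).aestronglyMeasurable,
    integral_indicator_const _ (hqi i), measureReal_def, hunif i, smul_eq_mul, mul_one,
    ENNReal.toReal_inv, ENNReal.toReal_natCast, mul_inv_cancel_left₀]
  exact_mod_cast Fintype.card_ne_zero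

theorem memLp_compress (F : HashFamily d c) (k : ℕ) {P : Measure Ω}
    {X : Ω → EuclideanSpace ℝ (Fin d)} (hXm : Measurable[m0] X) (hX : MemLp X 2 P)
    {q : Ω → Seed F r} (hq : Measurable[m0, ⊤] q) :
    MemLp (fun ω => compress F k (q ω) (X ω)) 2 P := by
  refine hX.mono (Measurable.aestronglyMeasurable ?_) (.of_forall fun ω => norm_compress_le _ _ _ _)
  exact measurable_select hq (G := fun θ ω => compress F k θ (X ω)) fun θ =>
    (measurable_compress F k θ).comp hXm

theorem integral_norm_sub_compress_sq_le (F : HashFamily d c) {k : ℕ} (hk : 0 < k)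
    (hkd : k ≤ d) (hc : 2500 * k ≤ c) (hr : 2 * ((d : ℝ) + 1) ≤ 5 ^ r)
    (P : Measure Ω) [IsProbabilityMeasure P] {m : MeasurableSpace Ω} (hm : m ≤ m0)
    {X : Ω → EuclideanSpace ℝ (Fin d)} (hXm : Measurable[m] X) (hX : MemLp X 2 P)
    {q : Ω → Seed F r} (hq : Measurable[m0, ⊤] q)
    (hunif : ∀ θ, P (q ⁻¹' {θ}) = (Fintype.card (Seed F r) : ENNReal)⁻¹)
    (hind : Indep (MeasurableSpace.comap q ⊤) m P) :
    ∫ ω, ‖X ω - compress F k (q ω) (X ω)‖ ^ 2 ∂P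
      ≤ (1 - k / (16 * d)) * ∫ ω, ‖X ω‖ ^ 2 ∂P := by
  have hX2 : Integrable (fun ω => ‖X ω‖ ^ 2) P := hX.integrable_norm_pow (by norm_num)
  have hφ : ∀ θ : Seed F r, Measurable fun x : EuclideanSpace ℝ (Fin d) =>
      ‖x - compress F k θ x‖ ^ 2 := fun θ =>
    ((measurable_id.sub (measurable_compress F k θ)).norm).pow_const 2
  have hint : ∀ θ : Seed F r, Integrable (fun ω => ‖X ω - compress F k θ (X ω)‖ ^ 2) P := by
    intro θ
    refine hX2.mono' ((hφ θ).comp (hXm.mono hm le_rfl)).aestronglyMeasurable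
      (.of_forall fun ω => ?_)
    rw [Real.norm_of_nonneg (by positivity)]
    gcongr
    exact norm_sub_compress_le _ _ _ _
  have h := integral_uniform_indep P hXm hq hunif hind hφ hint
  rw [← integral_finsetSum _ fun θ _ => hint θ] at h
  have h2 : ∫ ω, ∑ θ : Seed F r, ‖X ω - compress F k θ (X ω)‖ ^ 2 ∂P
      ≤ ∫ ω, Fintype.card (Seed F r) * ((1 - k / (16 * d)) * ‖X ω‖ ^ 2) ∂P :=
    integral_mono (integrable_finsetSum _ fun θ _ => hint θ) ((hX2.const_mul _).const_mul _)
      fun ω => sum_norm_sub_restrict_heavyMix_le F hk hkd hc hr (X ω)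
  rw [integral_const_mul, integral_const_mul] at h2
  have hN : (0 : ℝ) < Fintype.card (Seed F r) := by
    have : Nonempty (Seed F r) :=
      ⟨(fun _ => ⟨0, F.numBucket_pos⟩, fun _ => ⟨0, F.numSign_pos⟩, 1)⟩
    exact_mod_cast Fintype.card_pos
  exact le_of_mul_le_mul_left (h.trans_le h2) hN

end Contraction

/-! ## The run of the algorithm as a stochastic process -/

section Run

variable {d c r W : ℕ} {Ω : Type*} {m0 : MeasurableSpace Ω} {F : HashFamily d c} {k : ℕ}
  {η : ℕ → ℝ} {w₁ : EuclideanSpace ℝ (Fin d)} {g : ℕ → Fin W → Ω → EuclideanSpace ℝ (Fin d)}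
  {θ : ℕ → Ω → Seed F r}

theorem gradientInfo_le (hg : ∀ t i, Measurable (g t i)) (t : ℕ) : gradientInfo g t ≤ m0 :=
  iSup_le fun i => (hg t i).comap_le

theorem history_le (hg : ∀ t i, Measurable (g t i)) (hθ : ∀ t, Measurable[_, ⊤] (θ t)) (t : ℕ) :
    history g θ t ≤ m0 :=
  iSup₂_le fun s _ => sup_le (gradientInfo_le hg s) (hθ s).comap_le

theorem history_mono {s t : ℕ} (hst : s ≤ t) : history g θ s ≤ history g θ t :=
  biSup_mono fun _ hu => ⟨hu.1, hu.2.trans_le hst⟩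

theorem gradientInfo_le_history {t : ℕ} (ht : 1 ≤ t) :
    gradientInfo g t ≤ history g θ (t + 1) :=
  le_trans le_sup_left (le_iSup₂_of_le t ⟨ht, t.lt_succ_self⟩ le_rfl)

theorem comap_seed_le_history {t : ℕ} (ht : 1 ≤ t) :
    MeasurableSpace.comap (θ t) ⊤ ≤ history g θ (t + 1) :=
  le_trans le_sup_right (le_iSup₂_of_le t ⟨ht, t.lt_succ_self⟩ le_rfl)

theorem measurable_average_gradient (t : ℕ) :
    Measurable[gradientInfo g t] fun ω => average fun i => g t i ω := by
  unfold average
  have h : Measurable[gradientInfo g t] fun ω => ∑ i, g t i ω :=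
    Finset.measurable_sum _ fun i _ => Measurable.mono (comap_measurable (g t i))
      (le_iSup (fun i => MeasurableSpace.comap (g t i) inferInstance) i) le_rfl
  exact h.const_smul (1 / (W : ℝ))

theorem measurable_smul_add {m m₁ m₂ : MeasurableSpace Ω} (h₁ : m₁ ≤ m) (h₂ : m₂ ≤ m) (e : ℝ)
    {X Y : Ω → EuclideanSpace ℝ (Fin d)} (hX : Measurable[m₁] X) (hY : Measurable[m₂] Y) :
    Measurable[m] fun ω => e • X ω + Y ω :=
  ((hX.mono h₁ le_rfl).const_smul e).add (hY.mono h₂ le_rfl)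

/-- The parameters after `n` iterations. -/
noncomputable def parameters (F : HashFamily d c) (k : ℕ) (η : ℕ → ℝ)
    (w₁ : EuclideanSpace ℝ (Fin d)) (g : ℕ → Fin W → Ω → EuclideanSpace ℝ (Fin d))
    (θ : ℕ → Ω → Seed F r) (n : ℕ) (ω : Ω) : EuclideanSpace ℝ (Fin d) :=
  (state F k η w₁ (fun s i => g s i ω) (fun s => θ s ω) n).w

/-- The average of the workers' error vectors after `n` iterations. -/
noncomputable def meanError (F : HashFamily d c) (k : ℕ) (η : ℕ → ℝ)
    (w₁ : EuclideanSpace ℝ (Fin d)) (g : ℕ → Fin W → Ω → EuclideanSpace ℝ (Fin d))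
    (θ : ℕ → Ω → Seed F r) (n : ℕ) (ω : Ω) : EuclideanSpace ℝ (Fin d) :=
  average (state F k η w₁ (fun s i => g s i ω) (fun s => θ s ω) n).err

theorem parameters_zero (ω : Ω) : parameters F k η w₁ g θ 0 ω = w₁ := rfl

theorem meanError_zero (ω : Ω) : meanError F k η w₁ g θ 0 ω = 0 := average_zero

theorem parameters_succ (n : ℕ) (ω : Ω) :
    parameters F k η w₁ g θ (n + 1) ω = parameters F k η w₁ g θ n ω -
      compress F k (θ (n + 1) ω) (η (n + 1) • (average fun i => g (n + 1) i ω)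
        + meanError F k η w₁ g θ n ω) := by
  simp only [parameters, meanError, state, step, update_eq_compress]

theorem meanError_succ (hW : 0 < W) (n : ℕ) (ω : Ω) :
    meanError F k η w₁ g θ (n + 1) ω =
      (η (n + 1) • (average fun i => g (n + 1) i ω) + meanError F k η w₁ g θ n ω) -
      compress F k (θ (n + 1) ω) (η (n + 1) • (average fun i => g (n + 1) i ω)
        + meanError F k η w₁ g θ n ω) := by
  simp only [meanError, state, average_step_err hW]

/-- The compressed vector is subtracted from both the parameters and the error, so it cancels: the
difference performs uncompressed stochastic gradient descent. -/
theorem parameters_sub_meanError_succ (hW : 0 < W) (n : ℕ) (ω : Ω) :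
    parameters F k η w₁ g θ (n + 1) ω - meanError F k η w₁ g θ (n + 1) ω =
      parameters F k η w₁ g θ n ω - meanError F k η w₁ g θ n ω
        - η (n + 1) • (average fun i => g (n + 1) i ω) := by
  rw [parameters_succ, meanError_succ hW]
  abel

/-- The state after `n` iterations is known before iteration `n + 1`, hence the index of the
history. -/
theorem measurable_parameters_meanError (hW : 0 < W) (n : ℕ) :
    Measurable[history g θ (n + 1)] (parameters F k η w₁ g θ n) ∧
      Measurable[history g θ (n + 1)] (meanError F k η w₁ g θ n) := by
  induction n with
  | zero =>
    exact ⟨measurable_const, by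
      have : meanError F k η w₁ g θ 0 = fun _ => 0 := funext meanError_zero
      rw [this]
      exact measurable_const⟩
  | succ n ih =>
    have hle : history g θ (n + 1) ≤ history g θ (n + 1 + 1) := history_mono (Nat.le_succ _)
    have hp := ih.1.mono hle le_rfl
    have ha := ih.2.mono hle le_rfl
    have hX : Measurable[history g θ (n + 1 + 1)] fun ω =>
        η (n + 1) • (average fun i => g (n + 1) i ω) + meanError F k η w₁ g θ n ω :=
      measurable_smul_add (gradientInfo_le_history (by omega)) le_rfl _
        (measurable_average_gradient (n + 1)) ha
    have hq : Measurable[history g θ (n + 1 + 1), ⊤] (θ (n + 1)) :=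
      Measurable.of_comap_le (comap_seed_le_history (by omega))
    have hC : Measurable[history g θ (n + 1 + 1)] fun ω =>
        compress F k (θ (n + 1) ω) (η (n + 1) • (average fun i => g (n + 1) i ω)
          + meanError F k η w₁ g θ n ω) :=
      measurable_select hq (G := fun q ω => compress F k q
        (η (n + 1) • (average fun i => g (n + 1) i ω) + meanError F k η w₁ g θ n ω))
        fun q => (measurable_compress F k q).comp hX
    have e1 := funext (parameters_succ (F := F) (k := k) (η := η) (w₁ := w₁) (g := g) (θ := θ) n)
    have e2 := funext (meanError_succ (F := F) (k := k) (η := η) (w₁ := w₁) (g := g) (θ := θ) hW n)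
    rw [e1, e2]
    exact ⟨hp.sub hC, hX.sub hC⟩

theorem memLp_parameters_meanError (hW : 0 < W) (hg : ∀ t i, Measurable (g t i))
    (hθ : ∀ t, Measurable[_, ⊤] (θ t)) {P : Measure Ω} [IsProbabilityMeasure P] {T : ℕ}
    (hL2 : ∀ t ∈ Set.Icc 1 T, MemLp (fun ω => average fun i => g t i ω) 2 P) (n : ℕ)
    (hn : n ≤ T) :
    MemLp (parameters F k η w₁ g θ n) 2 P ∧ MemLp (meanError F k η w₁ g θ n) 2 P := by
  induction n with
  | zero =>
    exact ⟨memLp_const w₁, by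
      have : meanError F k η w₁ g θ 0 = fun _ => 0 := funext meanError_zero
      rw [this]
      exact memLp_const 0⟩
  | succ n ih =>
    obtain ⟨hp, ha⟩ := ih (by omega)
    have hX := ((hL2 (n + 1) ⟨by omega, hn⟩).const_smul (η (n + 1))).add ha
    have hXm : Measurable[m0] fun ω =>
        η (n + 1) • (average fun i => g (n + 1) i ω) + meanError F k η w₁ g θ n ω :=
      measurable_smul_add (gradientInfo_le hg _) (history_le hg hθ _) _
        (measurable_average_gradient (n + 1)) (measurable_parameters_meanError hW n).2
    have hC := memLp_compress F k hXm hX (hθ (n + 1))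
    have e1 := funext (parameters_succ (F := F) (k := k) (η := η) (w₁ := w₁) (g := g) (θ := θ) n)
    have e2 := funext (meanError_succ (F := F) (k := k) (η := η) (w₁ := w₁) (g := g) (θ := θ) hW n)
    rw [e1, e2]
    exact ⟨hp.sub hC, hX.sub hC⟩

/-- One step of the error recursion. -/
theorem integral_meanError_succ_le (hW : 0 < W) (hk : 0 < k) (hkd : k ≤ d) (hc : 2500 * k ≤ c)
    (hr : 2 * ((d : ℝ) + 1) ≤ 5 ^ r) (hg : ∀ t i, Measurable (g t i))
    (hθ : ∀ t, Measurable[_, ⊤] (θ t)) {P : Measure Ω} [IsProbabilityMeasure P] {T : ℕ}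
    (hL2 : ∀ t ∈ Set.Icc 1 T, MemLp (fun ω => average fun i => g t i ω) 2 P)
    (hunif : ∀ t ∈ Set.Icc 1 T, ∀ q : Seed F r,
      P (θ t ⁻¹' {q}) = (Fintype.card (Seed F r) : ENNReal)⁻¹)
    (hind : ∀ t ∈ Set.Icc 1 T, Indep (MeasurableSpace.comap (θ t) ⊤)
      (history g θ t ⊔ gradientInfo g t) P) (n : ℕ) (hn : n + 1 ≤ T) :
    ∫ ω, ‖meanError F k η w₁ g θ (n + 1) ω‖ ^ 2 ∂P ≤ (1 - k / (16 * d)) *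
      ∫ ω, ‖η (n + 1) • (average fun i => g (n + 1) i ω) + meanError F k η w₁ g θ n ω‖ ^ 2 ∂P := by
  simp_rw [meanError_succ hW]
  -- The vector compressed in iteration `n + 1` involves the past and the current gradients, so the
  -- seed has to be independent of both.
  refine integral_norm_sub_compress_sq_le F hk hkd hc hr P
    (m := history g θ (n + 1) ⊔ gradientInfo g (n + 1))
    (sup_le (history_le hg hθ _) (gradientInfo_le hg _)) ?_ ?_ (hθ (n + 1))
    (hunif _ ⟨by omega, hn⟩) (hind _ ⟨by omega, hn⟩)
  · exact measurable_smul_add le_sup_right le_sup_left _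
      (measurable_average_gradient (n + 1)) (measurable_parameters_meanError hW n).2
  · exact ((hL2 (n + 1) ⟨by omega, hn⟩).const_smul (η (n + 1))).add
      (memLp_parameters_meanError hW hg hθ hL2 n (by omega)).2

end Run

/-! ## Smooth strongly convex functions -/

section Functions

variable {d : ℕ} {f : EuclideanSpace ℝ (Fin d) → ℝ} {L μ : ℝ} {wstar : EuclideanSpace ℝ (Fin d)}

namespace IsSmoothStronglyConvex

theorem le_smoothness (hf : IsSmoothStronglyConvex f L μ) (hd : 0 < d) : μ ≤ L := by
  set y : EuclideanSpace ℝ (Fin d) := EuclideanSpace.single ⟨0, hd⟩ 1 with hy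
  have hn : ‖y‖ = 1 := by simp [hy]
  have h1 := hf.strongly_convex 0 y
  have h2 := hf.strongly_convex y 0
  have h3 := hf.smooth 0 y
  rw [zero_sub, norm_neg, inner_neg_right] at h2
  rw [sub_zero] at h1 h3
  have h4 : inner ℝ (gradient f y - gradient f 0) y ≤ L := by
    refine (real_inner_le_norm _ _).trans ?_
    rw [hn] at h3 ⊢
    linarith
  rw [inner_sub_left] at h4
  rw [hn] at h1 h2
  linarith

theorem gradient_min (hmin : ∀ w, f wstar ≤ f w) : gradient f wstar = 0 := by
  have h : IsLocalMin f wstar := Filter.Eventually.of_forall hmin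
  rw [gradient, h.fderiv_eq_zero, map_zero]

theorem continuous (hf : IsSmoothStronglyConvex f L μ) : Continuous f :=
  hf.differentiable.continuous

theorem continuous_gradient (hf : IsSmoothStronglyConvex f L μ) : Continuous (gradient f) := by
  have : LipschitzWith L.toNNReal (gradient f) := by
    refine LipschitzWith.of_dist_le_mul fun x y => ?_
    rw [dist_eq_norm, dist_eq_norm]
    refine (hf.smooth y x).trans ?_
    gcongr
    exact Real.le_coe_toNNReal L
  exact this.continuous

theorem norm_gradient_le (hf : IsSmoothStronglyConvex f L μ) (hmin : ∀ w, f wstar ≤ f w)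
    (w : EuclideanSpace ℝ (Fin d)) : ‖gradient f w‖ ≤ L * ‖w - wstar‖ := by
  simpa [gradient_min hmin] using hf.smooth wstar w

/-- Strong convexity at `y` and the Cauchy–Schwarz inequality give the quadratic upper bound with L
instead of L/2, which affects only constants. -/
theorem le_add_sq (hf : IsSmoothStronglyConvex f L μ) (hμ : 0 ≤ μ)
    (x y : EuclideanSpace ℝ (Fin d)) :
    f y ≤ f x + inner ℝ (gradient f x) (y - x) + L * ‖y - x‖ ^ 2 := by
  have h1 := hf.strongly_convex y x
  have h2 : inner ℝ (gradient f y - gradient f x) (y - x) ≤ L * ‖y - x‖ ^ 2 := by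
    refine (real_inner_le_norm _ _).trans ?_
    rw [sq, ← mul_assoc]
    exact mul_le_mul_of_nonneg_right (hf.smooth x y) (norm_nonneg _)
  rw [inner_sub_left] at h2
  rw [← neg_sub y x, inner_neg_right, norm_neg] at h1
  have h3 : 0 ≤ μ / 2 * ‖y - x‖ ^ 2 := by positivity
  linarith

theorem sub_min_le (hf : IsSmoothStronglyConvex f L μ) (hμ : 0 ≤ μ) (hmin : ∀ w, f wstar ≤ f w)
    (w : EuclideanSpace ℝ (Fin d)) : f w - f wstar ≤ L * ‖w - wstar‖ ^ 2 := by
  have h := hf.le_add_sq hμ wstar w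
  rw [gradient_min hmin, inner_zero_left] at h
  linarith

/-- A gradient step of length 1/(2L) decreases `f` by at least ‖∇f(w)‖²/(4L), and cannot go below
the minimum. -/
theorem norm_gradient_sq_le (hf : IsSmoothStronglyConvex f L μ) (hμ : 0 ≤ μ) (hL : 0 < L)
    (hmin : ∀ w, f wstar ≤ f w) (w : EuclideanSpace ℝ (Fin d)) :
    ‖gradient f w‖ ^ 2 ≤ 4 * L * (f w - f wstar) := by
  have h := hf.le_add_sq hμ w (w - (1 / (2 * L)) • gradient f w)
  have hm := hmin (w - (1 / (2 * L)) • gradient f w)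
  rw [sub_sub_cancel_left, inner_neg_right, inner_smul_right, real_inner_self_eq_norm_sq, norm_neg,
    norm_smul, mul_pow, Real.norm_of_nonneg (by positivity)] at h
  have e : L * ((1 / (2 * L)) ^ 2 * ‖gradient f w‖ ^ 2) = ‖gradient f w‖ ^ 2 / (4 * L) := by
    field_simp
    ring
  have e2 : 1 / (2 * L) * ‖gradient f w‖ ^ 2 = 2 * (‖gradient f w‖ ^ 2 / (4 * L)) := by
    field_simp
    ring
  rw [e, e2] at h
  have h2 : ‖gradient f w‖ ^ 2 / (4 * L) ≤ f w - f wstar := by linarith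
  rw [div_le_iff₀ (by positivity)] at h2
  linarith

theorem le_inner_gradient (hf : IsSmoothStronglyConvex f L μ)
    (w : EuclideanSpace ℝ (Fin d)) :
    f w - f wstar + μ / 2 * ‖w - wstar‖ ^ 2 ≤ inner ℝ (gradient f w) (w - wstar) := by
  have h := hf.strongly_convex w wstar
  rw [← neg_sub w wstar, inner_neg_right, norm_neg] at h
  linarith

/-- The strong convexity inequalities in both directions add up to μ‖w - w*‖² ≤ ⟨∇f(w), w - w*⟩.
Used at the starting point, to bound the initial distance by G/μ. -/
theorem mul_norm_sub_min_le (hf : IsSmoothStronglyConvex f L μ) (hμ : 0 ≤ μ)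
    (hmin : ∀ w, f wstar ≤ f w) (w : EuclideanSpace ℝ (Fin d)) :
    μ ^ 2 * ‖w - wstar‖ ^ 2 ≤ ‖gradient f w‖ ^ 2 := by
  have h1 := hf.le_inner_gradient (wstar := wstar) w
  have h2 := hf.strongly_convex wstar w
  rw [gradient_min hmin, inner_zero_left] at h2
  have h3 := real_inner_le_norm (gradient f w) (w - wstar)
  have h4 : μ * ‖w - wstar‖ * ‖w - wstar‖ ≤ ‖gradient f w‖ * ‖w - wstar‖ := by
    nlinarith
  rw [← mul_pow]
  rcases eq_or_lt_of_le (norm_nonneg (w - wstar)) with h | h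
  · rw [← h, mul_zero, zero_pow two_ne_zero]
    positivity
  · have := le_of_mul_le_mul_right h4 h
    gcongr

/-- Jensen's inequality for a weighted average. -/
theorem weighted_average_le (hf : IsSmoothStronglyConvex f L μ) (hμ : 0 ≤ μ) {ι : Type*}
    (s : Finset ι) (a : ι → ℝ) (ha : ∀ i ∈ s, 0 ≤ a i) (hs : 0 < ∑ i ∈ s, a i)
    (w : ι → EuclideanSpace ℝ (Fin d)) :
    f ((1 / ∑ i ∈ s, a i) • ∑ i ∈ s, a i • w i) ≤ (∑ i ∈ s, a i * f (w i)) / ∑ i ∈ s, a i := by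
  set v := (1 / ∑ i ∈ s, a i) • ∑ i ∈ s, a i • w i with hv
  have h1 : ∀ i ∈ s, a i * f v + a i * inner ℝ (gradient f v) (w i - v) ≤ a i * f (w i) := by
    intro i hi
    rw [← mul_add]
    refine mul_le_mul_of_nonneg_left ?_ (ha i hi)
    have h := hf.strongly_convex v (w i)
    have : 0 ≤ μ / 2 * ‖w i - v‖ ^ 2 := by positivity
    linarith
  have h2 := Finset.sum_le_sum h1
  have h3 : ∑ i ∈ s, a i * inner ℝ (gradient f v) (w i - v) = 0 := by
    simp_rw [← inner_smul_right]
    rw [← inner_sum]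
    simp_rw [smul_sub]
    rw [Finset.sum_sub_distrib, ← Finset.sum_smul, hv, smul_smul, mul_one_div_cancel hs.ne',
      one_smul, sub_self, inner_zero_right]
  rw [Finset.sum_add_distrib, h3, add_zero, ← Finset.sum_mul] at h2
  rw [le_div_iff₀ hs]
  linarith

theorem integrable_comp (hf : IsSmoothStronglyConvex f L μ) (hμ : 0 ≤ μ)
    (hmin : ∀ w, f wstar ≤ f w) {Ω : Type*} {m0 : MeasurableSpace Ω} {P : Measure Ω}
    [IsProbabilityMeasure P] {w : Ω → EuclideanSpace ℝ (Fin d)} (hw : MemLp w 2 P) :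
    Integrable (fun ω => f (w ω)) P := by
  have h1 : Integrable (fun ω => ‖w ω - wstar‖ ^ 2) P :=
    (hw.sub (memLp_const wstar)).integrable_norm_pow (by norm_num)
  have h2 : Integrable (fun ω => f (w ω) - f wstar) P := by
    refine (h1.const_mul L).mono'
      ((hf.continuous.comp_aestronglyMeasurable hw.1).sub aestronglyMeasurable_const)
      (.of_forall fun ω => ?_)
    rw [Real.norm_of_nonneg (sub_nonneg.2 (hmin _))]
    exact hf.sub_min_le hμ hmin _
  exact (h2.add (integrable_const (f wstar))).congr (.of_forall fun ω => by simp)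

theorem memLp_gradient (hf : IsSmoothStronglyConvex f L μ)
    (hmin : ∀ w, f wstar ≤ f w) {Ω : Type*} {m0 : MeasurableSpace Ω} {P : Measure Ω}
    [IsProbabilityMeasure P] {w : Ω → EuclideanSpace ℝ (Fin d)} (hw : MemLp w 2 P) :
    MemLp (fun ω => gradient f (w ω)) 2 P :=
  MemLp.of_le_mul (c := L) (hw.sub (memLp_const wstar))
    (hf.continuous_gradient.comp_aestronglyMeasurable hw.1)
    (.of_forall fun _ => hf.norm_gradient_le hmin _)

end IsSmoothStronglyConvex

end Functions

/-! ## One step of stochastic gradient descent with memory -/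

section Descent

theorem integrable_inner_of_memLp {d : ℕ} {Ω : Type*} {m0 : MeasurableSpace Ω}
    {P : Measure Ω} {u v : Ω → EuclideanSpace ℝ (Fin d)}
    (hu : MemLp u 2 P) (hv : MemLp v 2 P) : Integrable (fun ω => inner ℝ (u ω) (v ω)) P := by
  refine ((hu.integrable_norm_pow (by norm_num)).add
    (hv.integrable_norm_pow (by norm_num))).mono' (hu.1.inner hv.1) (.of_forall fun ω => ?_)
  have h := norm_inner_le_norm (𝕜 := ℝ) (u ω) (v ω)
  simp only [Pi.add_apply]
  nlinarith [sq_nonneg (‖u ω‖ - ‖v ω‖), sq_nonneg (‖u ω‖), sq_nonneg ‖v ω‖]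

variable {d : ℕ} {Ω : Type*} {m0 : MeasurableSpace Ω} {P : Measure Ω} [IsProbabilityMeasure P]
  {m : MeasurableSpace Ω}

/-- A conditional expectation may be replaced by its target when paired with a function that is
measurable with respect to the conditioning. -/
theorem integral_inner_condExp (hm : m ≤ m0) {u h Y : Ω → EuclideanSpace ℝ (Fin d)}
    (hu : MemLp u 2 P) (hY : MemLp Y 2 P) (hYm : Measurable[m] Y) (huh : P[u | m] =ᵐ[P] h) :
    ∫ ω, inner ℝ (u ω) (Y ω) ∂P = ∫ ω, inner ℝ (h ω) (Y ω) ∂P := by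
  have hint : Integrable (fun ω => inner ℝ (u ω) (Y ω)) P := integrable_inner_of_memLp hu hY
  have h1 : P[fun ω => inner ℝ (u ω) (Y ω) | m] =ᵐ[P] fun ω => inner ℝ ((P[u | m]) ω) (Y ω) :=
    condExp_bilin_of_stronglyMeasurable_right (m := m) (μ := P)
      (innerSL ℝ : EuclideanSpace ℝ (Fin d) →L[ℝ] EuclideanSpace ℝ (Fin d) →L[ℝ] ℝ)
      (f := u) (g := Y) hYm.stronglyMeasurable hint (hu.integrable (by norm_num))
  rw [← integral_condExp hm]
  refine integral_congr_ae ?_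
  filter_upwards [h1, huh] with ω h1 h2
  rw [h1, h2]

theorem integral_le_of_condExp_le (hm : m ≤ m0) {u : Ω → ℝ} {b : ℝ}
    (h : P[u | m] ≤ᵐ[P] fun _ => b) : ∫ ω, u ω ∂P ≤ b := by
  rw [← integral_condExp hm]
  calc _ ≤ ∫ _, b ∂P := integral_mono_ae integrable_condExp (integrable_const b) h
    _ = b := by simp

/-- Conditional Jensen in L²: E⟨u, h⟩ = E‖h‖², and 2⟨u, h⟩ ≤ ‖u‖² + ‖h‖². -/
theorem integral_norm_gradient_sq_le (hm : m ≤ m0) {u h : Ω → EuclideanSpace ℝ (Fin d)}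
    (hu : MemLp u 2 P) (hh : MemLp h 2 P) (hhm : Measurable[m] h) (huh : P[u | m] =ᵐ[P] h) :
    ∫ ω, ‖h ω‖ ^ 2 ∂P ≤ ∫ ω, ‖u ω‖ ^ 2 ∂P := by
  have h1 := integral_inner_condExp hm hu hh hhm huh
  simp_rw [real_inner_self_eq_norm_sq] at h1
  have hu2 : Integrable (fun ω => ‖u ω‖ ^ 2) P := hu.integrable_norm_pow (by norm_num)
  have hh2 : Integrable (fun ω => ‖h ω‖ ^ 2) P := hh.integrable_norm_pow (by norm_num)
  have h2 : ∫ ω, inner ℝ (u ω) (h ω) ∂P ≤ ∫ ω, (1 / 2 * ‖u ω‖ ^ 2 + 1 / 2 * ‖h ω‖ ^ 2) ∂P := by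
    refine integral_mono (integrable_inner_of_memLp hu hh)
      ((hu2.const_mul _).add (hh2.const_mul _)) fun ω => ?_
    have := real_inner_le_norm (u ω) (h ω)
    nlinarith [sq_nonneg (‖u ω‖ - ‖h ω‖)]
  rw [integral_add (hu2.const_mul _) (hh2.const_mul _), integral_const_mul, integral_const_mul]
    at h2
  linarith

/-- The mean drift of Z = w - a - w* is along ∇f(w). Of the factor 9, the cross term ⟨∇f(w), a⟩
costs 8, by Young's inequality and ‖∇f(w)‖² ≤ 4L(f(w) - f(w*)); replacing ‖w - w*‖² by ‖Z‖² in the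
strong convexity term costs 1. -/
theorem integral_descent_step (hm : m ≤ m0) {f : EuclideanSpace ℝ (Fin d) → ℝ} {L μ : ℝ}
    (hμ : 0 < μ) (hμL : μ ≤ L) (hf : IsSmoothStronglyConvex f L μ)
    {wstar : EuclideanSpace ℝ (Fin d)} (hmin : ∀ w, f wstar ≤ f w)
    {w a u : Ω → EuclideanSpace ℝ (Fin d)} (hw : MemLp w 2 P) (ha : MemLp a 2 P)
    (hu : MemLp u 2 P) (hwm : Measurable[m] w) (ham : Measurable[m] a)
    (hcond : P[u | m] =ᵐ[P] fun ω => gradient f (w ω)) {G σ η : ℝ} (hη : 0 ≤ η)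
    (hG : ∫ ω, ‖u ω‖ ^ 2 ∂P ≤ G ^ 2)
    (hσ : ∫ ω, ‖u ω - gradient f (w ω)‖ ^ 2 ∂P ≤ σ ^ 2) :
    ∫ ω, ‖w ω - a ω - η • u ω - wstar‖ ^ 2 ∂P ≤
      (1 - η * μ / 2) * ∫ ω, ‖w ω - a ω - wstar‖ ^ 2 ∂P - η * ((∫ ω, f (w ω) ∂P) - f wstar)
        + 9 * L * η * ∫ ω, ‖a ω‖ ^ 2 ∂P + 2 * η ^ 2 * σ ^ 2 + 32 * L * η ^ 3 * G ^ 2 := by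
  have hL : 0 < L := hμ.trans_le hμL
  set h : Ω → EuclideanSpace ℝ (Fin d) := fun ω => gradient f (w ω) with hh
  have hhL : MemLp h 2 P := hf.memLp_gradient hmin hw
  have hhm : Measurable[m] h := hf.continuous_gradient.measurable.comp hwm
  set Z : Ω → EuclideanSpace ℝ (Fin d) := fun ω => w ω - a ω - wstar with hZ
  have hZL : MemLp Z 2 P := (hw.sub ha).sub (memLp_const wstar)
  have hZm : Measurable[m] Z := (hwm.sub ham).sub measurable_const
  have iZ : Integrable (fun ω => ‖Z ω‖ ^ 2) P := hZL.integrable_norm_pow (by norm_num)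
  have iu : Integrable (fun ω => ‖u ω‖ ^ 2) P := hu.integrable_norm_pow (by norm_num)
  have ih : Integrable (fun ω => ‖h ω‖ ^ 2) P := hhL.integrable_norm_pow (by norm_num)
  have ia : Integrable (fun ω => ‖a ω‖ ^ 2) P := ha.integrable_norm_pow (by norm_num)
  have iuh : Integrable (fun ω => ‖u ω - h ω‖ ^ 2) P :=
    (hu.sub hhL).integrable_norm_pow (by norm_num)
  have iuZ : Integrable (fun ω => inner ℝ (u ω) (Z ω)) P := integrable_inner_of_memLp hu hZL
  have ihZ : Integrable (fun ω => inner ℝ (h ω) (Z ω)) P := integrable_inner_of_memLp hhL hZL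
  have ifw : Integrable (fun ω => f (w ω)) P := hf.integrable_comp hμ.le hmin hw
  have iΔ : Integrable (fun ω => f (w ω) - f wstar) P := ifw.sub (integrable_const _)
  have eΔ : ∫ ω, (f (w ω) - f wstar) ∂P = (∫ ω, f (w ω) ∂P) - f wstar := by
    rw [integral_sub ifw (integrable_const _)]
    simp
  rw [← eΔ]
  -- expansion of the square
  have e1 : ∫ ω, ‖w ω - a ω - η • u ω - wstar‖ ^ 2 ∂P = ∫ ω, ‖Z ω‖ ^ 2 ∂P
      - 2 * η * ∫ ω, inner ℝ (h ω) (Z ω) ∂P + η ^ 2 * ∫ ω, ‖u ω‖ ^ 2 ∂P := by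
    have : ∀ ω, ‖w ω - a ω - η • u ω - wstar‖ ^ 2
        = ‖Z ω‖ ^ 2 - 2 * η * inner ℝ (u ω) (Z ω) + η ^ 2 * ‖u ω‖ ^ 2 := by
      intro ω
      rw [show w ω - a ω - η • u ω - wstar = Z ω - η • u ω by simp only [hZ]; abel,
        norm_sub_sq_real, inner_smul_right, norm_smul, mul_pow, Real.norm_eq_abs, sq_abs,
        real_inner_comm]
      ring
    simp_rw [this]
    have i1 : Integrable (fun ω => ‖Z ω‖ ^ 2 - 2 * η * inner ℝ (u ω) (Z ω)) P :=
      iZ.sub (iuZ.const_mul _)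
    rw [integral_add i1 (iu.const_mul _),
      integral_sub iZ (iuZ.const_mul _), integral_const_mul, integral_const_mul,
      integral_inner_condExp hm hu hZL hZm hcond]
  -- the inner product
  have e2 : 3 / 4 * ∫ ω, (f (w ω) - f wstar) ∂P + μ / 4 * ∫ ω, ‖Z ω‖ ^ 2 ∂P
      - 9 / 2 * L * ∫ ω, ‖a ω‖ ^ 2 ∂P ≤ ∫ ω, inner ℝ (h ω) (Z ω) ∂P := by
    have i1 : Integrable (fun ω => 3 / 4 * (f (w ω) - f wstar) + μ / 4 * ‖Z ω‖ ^ 2) P :=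
      (iΔ.const_mul _).add (iZ.const_mul _)
    rw [← integral_const_mul, ← integral_const_mul, ← integral_const_mul,
      ← integral_add (iΔ.const_mul _) (iZ.const_mul _), ← integral_sub i1 (ia.const_mul _)]
    refine integral_mono (i1.sub (ia.const_mul _)) ihZ
      fun ω => ?_
    have h1 := hf.le_inner_gradient (wstar := wstar) (w ω)
    have h2 := hf.norm_gradient_sq_le hμ.le hL hmin (w ω)
    have h3 := real_inner_le_norm (h ω) (a ω)
    have h4 : inner ℝ (h ω) (Z ω) = inner ℝ (h ω) (w ω - wstar) - inner ℝ (h ω) (a ω) := by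
      rw [← inner_sub_right]
      congr 1
      simp only [hZ]
      abel
    have h5 : ‖h ω‖ * ‖a ω‖ ≤ 1 / 4 * (f (w ω) - f wstar) + 4 * L * ‖a ω‖ ^ 2 := by
      refine le_of_mul_le_mul_left (a := 16 * L) ?_ (by positivity)
      nlinarith [sq_nonneg (‖h ω‖ - 8 * L * ‖a ω‖)]
    have h6 : ‖Z ω‖ ^ 2 ≤ 2 * ‖w ω - wstar‖ ^ 2 + 2 * ‖a ω‖ ^ 2 := by
      have : ‖Z ω‖ ≤ ‖w ω - wstar‖ + ‖a ω‖ := by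
        rw [show Z ω = (w ω - wstar) - a ω by simp only [hZ]; abel]
        exact norm_sub_le _ _
      have := pow_le_pow_left₀ (norm_nonneg _) this 2
      nlinarith [sq_nonneg (‖w ω - wstar‖ - ‖a ω‖)]
    have h7 : μ * ‖Z ω‖ ^ 2 ≤ μ * (2 * ‖w ω - wstar‖ ^ 2 + 2 * ‖a ω‖ ^ 2) := by gcongr
    have h8 : μ * ‖a ω‖ ^ 2 ≤ L * ‖a ω‖ ^ 2 := by gcongr
    simp only
    rw [h4]
    linarith
  -- the second moment
  have e3 : ∫ ω, ‖u ω‖ ^ 2 ∂P ≤ 2 * σ ^ 2 + 2 * ∫ ω, ‖h ω‖ ^ 2 ∂P := by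
    have h1 : ∫ ω, ‖u ω‖ ^ 2 ∂P ≤ ∫ ω, (2 * ‖u ω - h ω‖ ^ 2 + 2 * ‖h ω‖ ^ 2) ∂P := by
      refine integral_mono iu ((iuh.const_mul _).add (ih.const_mul _)) fun ω => ?_
      have : ‖u ω‖ ≤ ‖u ω - h ω‖ + ‖h ω‖ := by
        simpa using norm_add_le (u ω - h ω) (h ω)
      have := pow_le_pow_left₀ (norm_nonneg _) this 2
      simp only
      nlinarith [sq_nonneg (‖u ω - h ω‖ - ‖h ω‖)]
    rw [integral_add (iuh.const_mul _) (ih.const_mul _), integral_const_mul, integral_const_mul]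
      at h1
    linarith
  have e4 : ∫ ω, ‖h ω‖ ^ 2 ∂P ≤ 4 * L * ∫ ω, (f (w ω) - f wstar) ∂P := by
    rw [← integral_const_mul]
    exact integral_mono ih (iΔ.const_mul _) fun ω => hf.norm_gradient_sq_le hμ.le hL hmin (w ω)
  have e5 : ∫ ω, ‖h ω‖ ^ 2 ∂P ≤ G ^ 2 :=
    (integral_norm_gradient_sq_le hm hu hhL hhm hcond).trans hG
  have hΔ0 : 0 ≤ ∫ ω, (f (w ω) - f wstar) ∂P :=
    integral_nonneg fun ω => sub_nonneg.2 (hmin _)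
  rw [e1]
  set Δ := ∫ ω, (f (w ω) - f wstar) ∂P
  set S := ∫ ω, ‖h ω‖ ^ 2 ∂P
  -- No bound η ≲ 1/L is assumed. For 16Lη ≤ 1 smoothness absorbs the gradient term into Δ; for
  -- larger steps it is at most ηG², and a factor 16Lη > 1 can be inserted.
  have e6 : η * S ≤ 1 / 4 * Δ + 16 * L * η ^ 2 * G ^ 2 := by
    by_cases hsmall : 16 * L * η ≤ 1
    · have h1 : η * S ≤ η * (4 * L * Δ) := by gcongr
      have h2 : 16 * L * η * Δ ≤ 1 * Δ := by gcongr
      have h3 : 0 ≤ 16 * L * η ^ 2 * G ^ 2 := by positivity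
      linarith
    · push Not at hsmall
      have h1 : η * S ≤ η * G ^ 2 := by gcongr
      have h2 : 1 * (η * G ^ 2) ≤ 16 * L * η * (η * G ^ 2) := by gcongr
      linarith
  have e7 := mul_le_mul_of_nonneg_left e6 hη
  have e8 := mul_le_mul_of_nonneg_left e2 hη
  have e9 := mul_le_mul_of_nonneg_left e3 (sq_nonneg η)
  linarith

end Descent

/-! ## Recursive inequalities -/

section Recursion

/-- A contracting recursion driven by squared step sizes `γ / (t + ξ)` is of the order of the
squared step size. -/
theorem le_of_contracting_recursion {τ ξ γ B : ℝ} (hτ : 0 < τ) (hτ1 : τ ≤ 1) (hξ : 0 < ξ)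
    (hB : 0 ≤ B) {e : ℕ → ℝ} {T : ℕ} (h0 : e 0 = 0)
    (hrec : ∀ n, n + 1 ≤ T →
      e (n + 1) ≤ (1 - τ / 2) * e n + 2 / τ * ((γ / ((n + 1 : ℕ) + ξ)) ^ 2 * B))
    (n : ℕ) (hn : n ≤ T) :
    e n ≤ 8 * (1 + 8 / (τ * ξ)) ^ 2 / τ ^ 2 * ((γ / ((n + 1 : ℕ) + ξ)) ^ 2 * B) := by
  set K := 8 * (1 + 8 / (τ * ξ)) ^ 2 / τ ^ 2 with hK
  have hK0 : 0 ≤ K := by positivity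
  have hτ8 : 8 ≤ 8 / τ := by
    rw [le_div_iff₀ hτ]
    linarith
  -- The induction runs with the index shifted by 8/τ, because the decay (1 - τ/2)(u + 1)² ≤ (1 -
  -- τ/4)u² is obtained from uτ ≥ 8. The price is the ratio (u + 1)/v ≤ 1 + 8/(τξ), squared in `K`;
  -- the factor 8/τ² fits the noise into the remaining slack τ/4.
  suffices h : e n ≤ K * ((γ / (n + (ξ + 8 / τ))) ^ 2 * B) by
    refine h.trans ?_
    rw [div_pow, div_pow]
    gcongr K * (γ ^ 2 / ?_ ^ 2 * B)
    push_cast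
    linarith
  induction n with
  | zero =>
    rw [h0]
    positivity
  | succ n ih =>
    have ih := ih (by omega)
    set u : ℝ := n + (ξ + 8 / τ) with hu
    have hn0 : (0 : ℝ) ≤ n := Nat.cast_nonneg n
    have hu0 : 8 / τ ≤ u := by linarith
    have hup : 0 < u := by linarith
    have huτ : 8 ≤ u * τ := by rwa [div_le_iff₀ hτ] at hu0
    have hu1 : ((n + 1 : ℕ) : ℝ) + (ξ + 8 / τ) = u + 1 := by
      push_cast
      ring
    rw [hu1]
    set v : ℝ := ((n + 1 : ℕ) : ℝ) + ξ with hv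
    have hv0 : ξ ≤ v := by
      rw [hv]
      push_cast
      linarith
    have hvp : 0 < v := hξ.trans_le hv0
    -- comparison of the two denominators
    have huv : u + 1 ≤ (1 + 8 / (τ * ξ)) * v := by
      have h1 : u + 1 = v + 8 / τ := by
        rw [hu, hv]
        push_cast
        ring
      have h2 : 8 / τ = 8 / (τ * ξ) * ξ := by field_simp
      have h3 : 8 / (τ * ξ) * ξ ≤ 8 / (τ * ξ) * v := by gcongr
      linarith
    have hnoise : 2 / τ * ((γ / v) ^ 2 * B) ≤ τ / 4 * (K * ((γ / (u + 1)) ^ 2 * B)) := by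
      have h1 : 1 / v ≤ (1 + 8 / (τ * ξ)) / (u + 1) := by
        rw [div_le_div_iff₀ hvp (by linarith)]
        linarith
      have h2 : (1 / v) ^ 2 ≤ ((1 + 8 / (τ * ξ)) / (u + 1)) ^ 2 :=
        pow_le_pow_left₀ (by positivity) h1 2
      calc 2 / τ * ((γ / v) ^ 2 * B) = 2 / τ * (γ ^ 2 * B) * (1 / v) ^ 2 := by ring
        _ ≤ 2 / τ * (γ ^ 2 * B) * ((1 + 8 / (τ * ξ)) / (u + 1)) ^ 2 := by gcongr
        _ = _ := by
          rw [hK, div_pow, div_pow]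
          field_simp
          ring
    have hdecay : (1 - τ / 2) * (K * ((γ / u) ^ 2 * B))
        ≤ (1 - τ / 4) * (K * ((γ / (u + 1)) ^ 2 * B)) := by
      have h1 : (1 - τ / 2) * (u + 1) ^ 2 ≤ (1 - τ / 4) * u ^ 2 := by
        have e1 : (1 - τ / 4) * u ^ 2 - (1 - τ / 2) * (u + 1) ^ 2
          = u * (u * τ - 8) / 4 + (u * τ - 1) + τ / 2 := by ring
        have : 0 ≤ u * (u * τ - 8) := mul_nonneg hup.le (by linarith)
        linarith
      have h2 : (1 - τ / 2) / u ^ 2 ≤ (1 - τ / 4) / (u + 1) ^ 2 := by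
        rw [div_le_div_iff₀ (by positivity) (by positivity)]
        exact h1
      calc _ = K * (γ ^ 2 * B) * ((1 - τ / 2) / u ^ 2) := by
            rw [div_pow]
            ring
        _ ≤ K * (γ ^ 2 * B) * ((1 - τ / 4) / (u + 1) ^ 2) := by gcongr
        _ = _ := by
            rw [div_pow]
            ring
    have h3 : (1 - τ / 2) * e n ≤ (1 - τ / 2) * (K * ((γ / u) ^ 2 * B)) :=
      mul_le_mul_of_nonneg_left ih (by linarith)
    linarith [hrec n hn]

/-- The weighted sum of the function values is controlled by a telescoping sum. -/
theorem weighted_sum_le {ξ γ μ B₁ B₂ : ℝ} (hξ : 0 < ξ) (hγ : 0 < γ) (hγμ : 8 ≤ γ * μ)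
    {D Δ : ℕ → ℝ} {T : ℕ} (hD : ∀ n, 0 ≤ D n)
    (hrec : ∀ n, n + 1 ≤ T → D (n + 1) ≤ (1 - γ / ((n + 1 : ℕ) + ξ) * μ / 2) * D n
      - γ / ((n + 1 : ℕ) + ξ) * Δ (n + 1) + B₁ * (γ / ((n + 1 : ℕ) + ξ)) ^ 2
      + B₂ * (γ / ((n + 1 : ℕ) + ξ)) ^ 3)
    (n : ℕ) (hn : n ≤ T) :
    ∑ t ∈ Finset.Icc 1 n, (ξ + t) ^ 2 * Δ t + (ξ + n) ^ 3 / γ * D n ≤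
      ξ ^ 3 / γ * D 0 + B₁ * γ * ∑ t ∈ Finset.Icc 1 n, (ξ + t) + B₂ * γ ^ 2 * n := by
  induction n with
  | zero => simp
  | succ n ih =>
    have ih := ih (by omega)
    rw [Finset.sum_Icc_succ_top (by omega), Finset.sum_Icc_succ_top (by omega)]
    have h := hrec n hn
    have hs1 : ξ + ((n + 1 : ℕ) : ℝ) = ((n + 1 : ℕ) : ℝ) + ξ := add_comm _ _
    rw [hs1]
    set s : ℝ := ((n + 1 : ℕ) : ℝ) + ξ with hs
    have hsn : ξ + (n : ℝ) = s - 1 := by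
      rw [hs]
      push_cast
      ring
    rw [hsn] at ih
    have hs1 : 1 ≤ s := by
      have : (0 : ℝ) ≤ n := Nat.cast_nonneg n
      rw [hs]
      push_cast
      linarith
    have hsp : 0 < s := by linarith
    have h1 := mul_le_mul_of_nonneg_left h (show 0 ≤ s ^ 3 / γ by positivity)
    have e1 : s ^ 3 / γ * ((1 - γ / s * μ / 2) * D n - γ / s * Δ (n + 1) + B₁ * (γ / s) ^ 2
        + B₂ * (γ / s) ^ 3)
        = (s ^ 3 - s ^ 2 * (γ * μ) / 2) / γ * D n - s ^ 2 * Δ (n + 1) + B₁ * γ * s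
          + B₂ * γ ^ 2 := by
      field_simp
    rw [e1] at h1
    -- Telescoping needs s³ - (γμ/2)s² ≤ (s - 1)³; since γμ/2 ≥ 4 this follows from s² + 3s ≥ 1.
    have h2 : (s ^ 3 - s ^ 2 * (γ * μ) / 2) / γ * D n ≤ (s - 1) ^ 3 / γ * D n := by
      refine mul_le_mul_of_nonneg_right ?_ (hD n)
      gcongr
      nlinarith [mul_le_mul_of_nonneg_left hγμ (sq_nonneg s)]
    push_cast
    linarith

theorem sum_shift_le (ξ : ℝ) (T : ℕ) : ∑ t ∈ Finset.Icc 1 T, (ξ + t) ≤ T * ξ + (T : ℝ) ^ 2 := by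
  calc ∑ t ∈ Finset.Icc 1 T, (ξ + t) ≤ ∑ _t ∈ Finset.Icc 1 T, (ξ + T) := by
        refine Finset.sum_le_sum fun t ht => ?_
        have : (t : ℝ) ≤ T := by exact_mod_cast (Finset.mem_Icc.1 ht).2
        linarith
    _ = _ := by
        simp
        ring

theorem mul_sq_le_sum_sq {ξ : ℝ} (hξ : 0 ≤ ξ) (T : ℕ) :
    ξ * (T : ℝ) ^ 2 ≤ ∑ t ∈ Finset.Icc 1 T, (ξ + t) ^ 2 := by
  induction T with
  | zero => simp
  | succ n ih =>
    rw [Finset.sum_Icc_succ_top (by omega)]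
    push_cast
    have : (0 : ℝ) ≤ n := Nat.cast_nonneg n
    nlinarith [sq_nonneg ξ]

theorem cube_le_sum_sq {ξ : ℝ} (hξ : 0 ≤ ξ) (T : ℕ) :
    (T : ℝ) ^ 3 ≤ 3 * ∑ t ∈ Finset.Icc 1 T, (ξ + t) ^ 2 := by
  induction T with
  | zero => simp
  | succ n ih =>
    rw [Finset.sum_Icc_succ_top (by omega)]
    push_cast
    have hn : (0 : ℝ) ≤ n := Nat.cast_nonneg n
    have : ((n : ℝ) + 1) ^ 2 ≤ (ξ + (n + 1)) ^ 2 :=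
      pow_le_pow_left₀ (by linarith) (by linarith) 2
    nlinarith

/-- The final rate from the telescoped sum. -/
theorem rate_le {A R Z μ L G σ ξ γ K D₀ Q S : ℝ} {T : ℕ} (hT : 0 < T) (hμ : 0 < μ) (hμL : μ ≤ L)
    (hR : 1 ≤ R) (hξ : 0 < ξ) (hξA : ξ ≤ A * R) (hγμ : 8 ≤ γ * μ) (hγA : γ * μ ≤ A)
    (hD₀ : μ ^ 2 * D₀ ≤ G ^ 2) (hD0 : 0 ≤ D₀) (hZ : 0 ≤ Z) (hK : K ≤ Z * R ^ 2)
    (hQ1 : ξ * (T : ℝ) ^ 2 ≤ Q) (hQ2 : (T : ℝ) ^ 3 ≤ 3 * Q) (hS : S ≤ T * ξ + (T : ℝ) ^ 2) :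
    (ξ ^ 3 / γ * D₀ + 2 * σ ^ 2 * γ * S + (9 * L * K * G ^ 2 + 32 * L * G ^ 2) * γ ^ 2 * T) / Q
      ≤ (8 * A) * (σ ^ 2 / (μ * T))
        + A ^ 2 * (1 + 3 * (9 * Z + 32)) * (R ^ 2 * G ^ 2 * L / (μ ^ 2 * T ^ 2)) := by
  have hT' : (0 : ℝ) < T := by exact_mod_cast hT
  have hQ : 0 < Q := lt_of_lt_of_le (by positivity) hQ1
  have hγ : 0 < γ := by
    by_contra! h
    nlinarith
  have hL : 0 < L := hμ.trans_le hμL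
  have hA : 0 < A := by linarith
  have hγ' : γ ≤ A / μ := by rwa [le_div_iff₀ hμ]
  -- One factor ξ is spent against Q ≥ ξT², the other two against ξ ≤ AR; then 1/γ ≤ μ ≤ L and D₀ ≤
  -- G²/μ².
  have t1 : ξ ^ 3 / γ * D₀ / Q ≤ A ^ 2 * (R ^ 2 * G ^ 2 * L / (μ ^ 2 * T ^ 2)) := by
    have h1 : 1 / γ ≤ μ := by
      rw [div_le_iff₀ hγ]
      linarith
    have h2 : D₀ ≤ G ^ 2 / μ ^ 2 := by
      rw [le_div_iff₀ (by positivity)]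
      linarith
    have h3 : ξ / Q ≤ 1 / (T : ℝ) ^ 2 := by
      rw [div_le_div_iff₀ hQ (by positivity)]
      linarith
    calc ξ ^ 3 / γ * D₀ / Q = ξ ^ 2 * (1 / γ) * D₀ * (ξ / Q) := by ring
      _ ≤ (A * R) ^ 2 * μ * (G ^ 2 / μ ^ 2) * (1 / (T : ℝ) ^ 2) := by gcongr
      _ ≤ (A * R) ^ 2 * L * (G ^ 2 / μ ^ 2) * (1 / (T : ℝ) ^ 2) := by gcongr
      _ = _ := by ring
  have t2 : 2 * σ ^ 2 * γ * S / Q ≤ (8 * A) * (σ ^ 2 / (μ * T)) := by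
    have h1 : S / Q ≤ 4 / T := by
      rw [div_le_div_iff₀ hQ hT']
      calc S * T ≤ (T * ξ + (T : ℝ) ^ 2) * T := by gcongr
        _ = ξ * (T : ℝ) ^ 2 + (T : ℝ) ^ 3 := by ring
        _ ≤ _ := by linarith
    calc 2 * σ ^ 2 * γ * S / Q = 2 * σ ^ 2 * γ * (S / Q) := by ring
      _ ≤ 2 * σ ^ 2 * γ * (4 / T) := by gcongr
      _ ≤ 2 * σ ^ 2 * (A / μ) * (4 / T) := by gcongr
      _ = _ := by
        field_simp
        ring
  have t3 : (9 * L * K * G ^ 2 + 32 * L * G ^ 2) * γ ^ 2 * T / Q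
      ≤ A ^ 2 * (3 * (9 * Z + 32)) * (R ^ 2 * G ^ 2 * L / (μ ^ 2 * T ^ 2)) := by
    have h1 : (T : ℝ) / Q ≤ 3 / (T : ℝ) ^ 2 := by
      rw [div_le_div_iff₀ hQ (by positivity)]
      linarith
    have hR2 : 1 ≤ R ^ 2 := one_le_pow₀ hR
    have h2 : 9 * L * K * G ^ 2 + 32 * L * G ^ 2 ≤ (9 * Z + 32) * (R ^ 2 * G ^ 2 * L) := by
      have h3 : 9 * L * K * G ^ 2 ≤ 9 * L * (Z * R ^ 2) * G ^ 2 := by gcongr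
      have h4 : 32 * L * G ^ 2 * 1 ≤ 32 * L * G ^ 2 * R ^ 2 := by gcongr
      linarith
    calc (9 * L * K * G ^ 2 + 32 * L * G ^ 2) * γ ^ 2 * T / Q
        = (9 * L * K * G ^ 2 + 32 * L * G ^ 2) * γ ^ 2 * (T / Q) := by ring
      _ ≤ (9 * Z + 32) * (R ^ 2 * G ^ 2 * L) * (A / μ) ^ 2 * (3 / (T : ℝ) ^ 2) := by gcongr
      _ = _ := by
        field_simp
  rw [add_div, add_div]
  linarith

end Recursion

/-! ## Communication -/

section Communication

variable {d c r W : ℕ}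

theorem communication_eq (b : ℕ) (F : HashFamily d c) (k : ℕ) (θ : Seed F r) (η : ℝ)
    (g : Fin W → EuclideanSpace ℝ (Fin d)) (s : State d W) :
    communication b F k θ η g s = W * (r * c * b + ((selected F k θ η g s).card * Nat.clog 2 d +
      ((selected F k θ η g s).card * b + (selected F k θ η g s).card * (Nat.clog 2 d + b)))) := by
  simp [communication, messages, Message.bits]

theorem clog_le_log {d T : ℕ} (hd : 0 < d) (hT : 0 < T) :
    (Nat.clog 2 d : ℝ) ≤ 2 * (1 + Real.log (d * T)) := by
  have hd1 : (1 : ℝ) ≤ d := by exact_mod_cast hd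
  have hT1 : (1 : ℝ) ≤ T := by exact_mod_cast hT
  have h0 : 0 ≤ Real.log d := Real.log_nonneg hd1
  have h0' : 0 ≤ Real.log T := Real.log_nonneg hT1
  have h1 : (Nat.clog 2 d : ℝ) ≤ Real.logb 2 d + 1 := by
    have h := Real.natCeil_logb_natCast 2 d
    rw [← h]
    exact (Nat.ceil_lt_add_one (Real.logb_nonneg (by norm_num) hd1)).le
  have h2 : Real.logb 2 d ≤ 2 * Real.log d := by
    rw [Real.logb, div_le_iff₀ (Real.log_pos (by norm_num))]
    nlinarith [Real.log_two_gt_d9]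
  rw [Real.log_mul (by positivity) (by positivity)]
  linarith

theorem communication_bounds {A : ℝ} {b k T : ℕ} (hb : 0 < b) (hk : 0 < k) (hkd : k ≤ d)
    (hT : 0 < T) (hc : 2500 * (k : ℝ) ≤ c) (hcA : c ≤ A * k)
    (hr : 2500 * (1 + Real.log (d * T)) ≤ r) (hrA : r ≤ A * (1 + Real.log (d * T)))
    (F : HashFamily d c) (η : ℝ) (θ : Seed F r)
    (g : Fin W → EuclideanSpace ℝ (Fin d)) (s : State d W) :
    2500 ^ 2 * (k * (1 + Real.log (d * T)) * W) ≤ communication b F k θ η g s ∧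
      communication b F k θ η g s
        ≤ (A ^ 2 * b + 4 + 2 * b) * (k * (1 + Real.log (d * T)) * W) := by
  have hk' : (0 : ℝ) < k := by exact_mod_cast hk
  have hb' : (1 : ℝ) ≤ b := by exact_mod_cast hb
  have hclog := clog_le_log (hk.trans_le hkd) hT
  have hd1 : (1 : ℝ) ≤ d := by exact_mod_cast hk.trans_le hkd
  have hT1 : (1 : ℝ) ≤ T := by exact_mod_cast hT
  have hlog : 0 ≤ Real.log (d * T) := Real.log_nonneg (one_le_mul_of_one_le_of_one_le hd1 hT1)
  set Λ := 1 + Real.log (d * T) with hΛ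
  have hΛ1 : 1 ≤ Λ := by linarith
  have hsel : ((selected F k θ η g s).card : ℝ) ≤ k := by
    exact_mod_cast card_heavyMix_le F θ k _
  rw [communication_eq]
  set n := (selected F k θ η g s).card
  set q := Nat.clog 2 d
  push_cast
  have hq0 : (0 : ℝ) ≤ q := Nat.cast_nonneg _
  have hn0 : (0 : ℝ) ≤ n := Nat.cast_nonneg _
  have hc0 : (0 : ℝ) ≤ c := Nat.cast_nonneg _
  have hr0 : (0 : ℝ) ≤ r := Nat.cast_nonneg _
  constructor
  -- The sketches alone give the lower bound.
  · calc 2500 ^ 2 * (k * Λ * W) = W * ((2500 * Λ) * (2500 * k) * 1) := by ring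
      _ ≤ W * (r * c * b + 0) := by
        rw [add_zero]
        gcongr
      _ ≤ _ := by
        gcongr
        positivity
  · calc (W : ℝ) * (r * c * b + (n * q + (n * b + n * (q + b))))
        ≤ W * ((A * Λ) * (A * k) * b + (k * (2 * Λ) + (k * b + k * (2 * Λ + b)))) := by
          gcongr
          exact hr0.trans hrA
      _ = W * (A ^ 2 * b * k * Λ + 4 * k * Λ + 2 * b * k * 1) := by ring
      _ ≤ W * (A ^ 2 * b * k * Λ + 4 * k * Λ + 2 * b * k * Λ) := by gcongr
      _ = _ := by ring

end Communication

/-! ## Convergence -/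

section Convergence

/-- Uses r ≥ 3 + log d, e³ ≥ 4 and e < 5. Success with probability 1/2 in each iteration is enough,
as the contraction is needed only in expectation; no union bound over iterations is taken. -/
theorem two_mul_add_one_le_five_pow {d T r : ℕ} (hd : 0 < d) (hT : 0 < T)
    (hr : 2500 * (1 + Real.log (d * T)) ≤ r) : 2 * ((d : ℝ) + 1) ≤ 5 ^ r := by
  have hd1 : (1 : ℝ) ≤ d := by exact_mod_cast hd
  have hT1 : (1 : ℝ) ≤ T := by exact_mod_cast hT
  have h0 : 0 ≤ Real.log d := Real.log_nonneg hd1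
  have h0' : 0 ≤ Real.log T := Real.log_nonneg hT1
  rw [Real.log_mul (by positivity) (by positivity)] at hr
  have h1 : 3 + Real.log d ≤ r := by linarith
  have h2 : (4 : ℝ) ≤ Real.exp 3 := by linarith [Real.add_one_le_exp (3 : ℝ)]
  calc 2 * ((d : ℝ) + 1) ≤ 4 * d := by linarith
    _ ≤ Real.exp 3 * d := by gcongr
    _ = Real.exp (3 + Real.log d) := by rw [Real.exp_add, Real.exp_log (by linarith)]
    _ ≤ Real.exp r := Real.exp_le_exp.2 h1
    _ = Real.exp 1 ^ r := by rw [← Real.exp_nat_mul, mul_one]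
    _ ≤ 5 ^ r := by
      gcongr
      linarith [Real.exp_one_lt_d9]

/-- Young's inequality in the form used for contractions with memory. -/
theorem one_sub_mul_norm_add_sq_le {d : ℕ} {τ : ℝ} (hτ : 0 < τ) (hτ1 : τ ≤ 1)
    (x y : EuclideanSpace ℝ (Fin d)) :
    (1 - τ) * ‖x + y‖ ^ 2 ≤ 2 / τ * ‖x‖ ^ 2 + (1 - τ / 2) * ‖y‖ ^ 2 := by
  have h1 : ‖x + y‖ ^ 2 ≤ (1 + 2 / τ) * ‖x‖ ^ 2 + (1 + τ / 2) * ‖y‖ ^ 2 := by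
    have h2 := pow_le_pow_left₀ (norm_nonneg _) (norm_add_le x y) 2
    have h3 : 2 * ‖x‖ * ‖y‖ ≤ 2 / τ * ‖x‖ ^ 2 + τ / 2 * ‖y‖ ^ 2 := by
      refine le_of_mul_le_mul_left (a := 2 * τ) ?_ (by positivity)
      have : 2 * τ * (2 / τ * ‖x‖ ^ 2 + τ / 2 * ‖y‖ ^ 2)
          = 4 * ‖x‖ ^ 2 + τ ^ 2 * ‖y‖ ^ 2 := by
        field_simp
        ring
      rw [this]
      nlinarith [sq_nonneg (2 * ‖x‖ - τ * ‖y‖)]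
    linarith
  have h4 := mul_le_mul_of_nonneg_left h1 (show 0 ≤ 1 - τ by linarith)
  have e1 : (1 - τ) * (1 + 2 / τ) = 2 / τ - 1 - τ := by
    field_simp
    ring
  have h5 : (1 - τ) * ((1 + 2 / τ) * ‖x‖ ^ 2) ≤ 2 / τ * ‖x‖ ^ 2 := by
    rw [← mul_assoc, e1]
    gcongr
    linarith
  have h6 : (1 - τ) * ((1 + τ / 2) * ‖y‖ ^ 2) ≤ (1 - τ / 2) * ‖y‖ ^ 2 := by
    rw [← mul_assoc]
    gcongr
    nlinarith
  linarith

variable {d c r W : ℕ} {Ω : Type*} {m0 : MeasurableSpace Ω} {F : HashFamily d c} {k : ℕ}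
  {w₁ : EuclideanSpace ℝ (Fin d)} {g : ℕ → Fin W → Ω → EuclideanSpace ℝ (Fin d)}
  {θ : ℕ → Ω → Seed F r} {P : Measure Ω} [IsProbabilityMeasure P] {T : ℕ}

/-- Young's inequality gives up half of the contraction rate τ, at the price of a factor 2/τ on the
fresh gradient; `le_of_contracting_recursion` then applies. -/
theorem integral_meanError_sq_le (hW : 0 < W) (hk : 0 < k) (hkd : k ≤ d) (hc : 2500 * k ≤ c)
    (hr : 2 * ((d : ℝ) + 1) ≤ 5 ^ r) {ξ γ G : ℝ} (hξ : 0 < ξ) {η : ℕ → ℝ}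
    (hη : ∀ t : ℕ, η t = γ / (t + ξ)) (hg : ∀ t i, Measurable (g t i))
    (hθ : ∀ t, Measurable[_, ⊤] (θ t))
    (hL2 : ∀ t ∈ Set.Icc 1 T, MemLp (fun ω => average fun i => g t i ω) 2 P)
    (hunif : ∀ t ∈ Set.Icc 1 T, ∀ q : Seed F r,
      P (θ t ⁻¹' {q}) = (Fintype.card (Seed F r) : ENNReal)⁻¹)
    (hind : ∀ t ∈ Set.Icc 1 T, Indep (MeasurableSpace.comap (θ t) ⊤)
      (history g θ t ⊔ gradientInfo g t) P)
    (hG : ∀ t ∈ Set.Icc 1 T, ∫ ω, ‖average fun i => g t i ω‖ ^ 2 ∂P ≤ G ^ 2) (n : ℕ)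
    (hn : n ≤ T) :
    ∫ ω, ‖meanError F k η w₁ g θ n ω‖ ^ 2 ∂P ≤
      8 * (1 + 8 / (k / (16 * d) * ξ)) ^ 2 / (k / (16 * d)) ^ 2 * (η (n + 1) ^ 2 * G ^ 2) := by
  have hk' : (0 : ℝ) < k := by exact_mod_cast hk
  have hkd' : (k : ℝ) ≤ d := by exact_mod_cast hkd
  have hd' : (0 : ℝ) < d := hk'.trans_le hkd'
  set τ : ℝ := k / (16 * d) with hτdef
  have hτ : 0 < τ := by positivity
  have hτ1 : τ ≤ 1 := by
    rw [hτdef, div_le_one (by positivity)]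
    linarith
  rw [hη (n + 1)]
  refine le_of_contracting_recursion hτ hτ1 hξ (sq_nonneg G)
    (e := fun n => ∫ ω, ‖meanError F k η w₁ g θ n ω‖ ^ 2 ∂P) (T := T) ?_ (fun n hn => ?_) n hn
  · simp [meanError_zero]
  · rw [← hη (n + 1)]
    have h1 := integral_meanError_succ_le (η := η) (w₁ := w₁) hW hk hkd hc hr hg hθ hL2 hunif
      hind n hn
    have hu := hL2 (n + 1) ⟨by omega, hn⟩
    have ha : MemLp (meanError F k η w₁ g θ n) 2 P :=
      (memLp_parameters_meanError hW hg hθ hL2 n (by omega)).2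
    have iu : Integrable (fun ω => ‖average fun i => g (n + 1) i ω‖ ^ 2) P :=
      hu.integrable_norm_pow (by norm_num)
    have ia : Integrable (fun ω => ‖meanError F k η w₁ g θ n ω‖ ^ 2) P :=
      ha.integrable_norm_pow (by norm_num)
    have iX : Integrable (fun ω => ‖η (n + 1) • (average fun i => g (n + 1) i ω)
        + meanError F k η w₁ g θ n ω‖ ^ 2) P :=
      ((hu.const_smul (η (n + 1))).add ha).integrable_norm_pow (by norm_num)
    refine h1.trans ?_
    rw [← integral_const_mul]
    calc ∫ ω, (1 - τ) * ‖η (n + 1) • (average fun i => g (n + 1) i ω)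
          + meanError F k η w₁ g θ n ω‖ ^ 2 ∂P
        ≤ ∫ ω, (2 / τ * η (n + 1) ^ 2 * ‖average fun i => g (n + 1) i ω‖ ^ 2
          + (1 - τ / 2) * ‖meanError F k η w₁ g θ n ω‖ ^ 2) ∂P := by
          refine integral_mono (iX.const_mul _) ((iu.const_mul _).add (ia.const_mul _))
            fun ω => ?_
          refine (one_sub_mul_norm_add_sq_le hτ hτ1 _ _).trans_eq ?_
          rw [norm_smul, mul_pow, Real.norm_eq_abs, sq_abs]
          ring
      _ = 2 / τ * η (n + 1) ^ 2 * ∫ ω, ‖average fun i => g (n + 1) i ω‖ ^ 2 ∂P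
          + (1 - τ / 2) * ∫ ω, ‖meanError F k η w₁ g θ n ω‖ ^ 2 ∂P := by
          rw [integral_add (iu.const_mul _) (ia.const_mul _), integral_const_mul,
            integral_const_mul]
      _ ≤ 2 / τ * η (n + 1) ^ 2 * G ^ 2
          + (1 - τ / 2) * ∫ ω, ‖meanError F k η w₁ g θ n ω‖ ^ 2 ∂P := by
          gcongr
          exact hG (n + 1) ⟨by omega, hn⟩
      _ = _ := by ring

theorem integrable_and_integral_average_sub_le {f : EuclideanSpace ℝ (Fin d) → ℝ} {L μ : ℝ}
    (hμ : 0 < μ) (hf : IsSmoothStronglyConvex f L μ) {wstar : EuclideanSpace ℝ (Fin d)}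
    (hmin : ∀ w, f wstar ≤ f w) {a : ℕ → ℝ} (s : Finset ℕ) (ha : ∀ t ∈ s, 0 ≤ a t)
    (hs : 0 < ∑ t ∈ s, a t) {w : ℕ → Ω → EuclideanSpace ℝ (Fin d)}
    (hw : ∀ t ∈ s, MemLp (w t) 2 P) :
    Integrable (fun ω => f ((1 / ∑ t ∈ s, a t) • ∑ t ∈ s, a t • w t ω)) P ∧
      (∫ ω, f ((1 / ∑ t ∈ s, a t) • ∑ t ∈ s, a t • w t ω) ∂P) - f wstar ≤
        (∑ t ∈ s, a t * ((∫ ω, f (w t ω) ∂P) - f wstar)) / ∑ t ∈ s, a t := by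
  have hL2 : MemLp (fun ω => (1 / ∑ t ∈ s, a t) • ∑ t ∈ s, a t • w t ω) 2 P := by
    have h := memLp_finsetSum (μ := P) s (f := fun t ω => a t • w t ω) fun t ht =>
      (hw t ht).const_smul (a t)
    exact h.const_smul (1 / ∑ t ∈ s, a t)
  have hint := hf.integrable_comp hμ.le hmin hL2
  have hintw : ∀ t ∈ s, Integrable (fun ω => a t * f (w t ω)) P := fun t ht =>
    (hf.integrable_comp hμ.le hmin (hw t ht)).const_mul _
  refine ⟨hint, ?_⟩
  have h1 : ∫ ω, f ((1 / ∑ t ∈ s, a t) • ∑ t ∈ s, a t • w t ω) ∂P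
      ≤ ∫ ω, (∑ t ∈ s, a t * f (w t ω)) / ∑ t ∈ s, a t ∂P :=
    integral_mono hint ((integrable_finsetSum s hintw).div_const _) fun ω =>
      hf.weighted_average_le hμ.le s a ha hs fun t => w t ω
  rw [integral_div, integral_finsetSum s hintw] at h1
  simp_rw [integral_const_mul] at h1
  simp_rw [mul_sub, Finset.sum_sub_distrib]
  rw [← Finset.sum_mul, sub_div, mul_div_cancel_left₀ _ hs.ne']
  linarith

theorem convergence {A R Z L μ ξ γ G σ : ℝ} (hW : 0 < W) (hk : 0 < k) (hkd : k ≤ d) (hT : 0 < T)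
    (hc : 2500 * k ≤ c) (hr : 2 * ((d : ℝ) + 1) ≤ 5 ^ r)
    {f : EuclideanSpace ℝ (Fin d) → ℝ} (hμ : 0 < μ) (hf : IsSmoothStronglyConvex f L μ)
    {wstar : EuclideanSpace ℝ (Fin d)} (hmin : ∀ w, f wstar ≤ f w)
    (hR : R = d / k) (hZ : 0 ≤ Z) (hRξ : R ≤ Z * ξ) (hξ : 0 < ξ) (hξA : ξ ≤ A * R)
    (hγμ : 8 ≤ γ * μ) (hγA : γ * μ ≤ A) {η : ℕ → ℝ} (hη : ∀ t : ℕ, η t = γ / (t + ξ))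
    (hg : ∀ t i, Measurable (g t i)) (hθ : ∀ t, Measurable[_, ⊤] (θ t))
    (hunif : ∀ t ∈ Set.Icc 1 T, ∀ q : Seed F r,
      P (θ t ⁻¹' {q}) = (Fintype.card (Seed F r) : ENNReal)⁻¹)
    (hind : ∀ t ∈ Set.Icc 1 T, Indep (MeasurableSpace.comap (θ t) ⊤)
      (history g θ t ⊔ gradientInfo g t) P)
    (hL2 : ∀ t ∈ Set.Icc 1 T, MemLp (fun ω => average fun i => g t i ω) 2 P)
    (hcond : ∀ t ∈ Set.Icc 1 T, P[fun ω => average fun i => g t i ω | history g θ t] =ᵐ[P]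
      fun ω => gradient f (parameters F k η w₁ g θ (t - 1) ω))
    (hG : ∀ t ∈ Set.Icc 1 T, ∫ ω, ‖average fun i => g t i ω‖ ^ 2 ∂P ≤ G ^ 2)
    (hσ : ∀ t ∈ Set.Icc 1 T, ∫ ω, ‖(average fun i => g t i ω)
      - gradient f (parameters F k η w₁ g θ (t - 1) ω)‖ ^ 2 ∂P ≤ σ ^ 2) :
    let what := fun ω => output F k η ξ w₁ (fun s i => g s i ω) (fun s => θ s ω) T
    Integrable (fun ω => f (what ω)) P ∧ (∫ ω, f (what ω) ∂P) - f wstar ≤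
      (8 * A) * (σ ^ 2 / (μ * T)) +
        A ^ 2 * (1 + 3 * (9 * (2048 * (1 + 128 * Z) ^ 2) + 32)) *
          (R ^ 2 * G ^ 2 * L / (μ ^ 2 * T ^ 2)) := by
  intro what
  have hk' : (0 : ℝ) < k := by exact_mod_cast hk
  have hkd' : (k : ℝ) ≤ d := by exact_mod_cast hkd
  have hd' : (0 : ℝ) < d := hk'.trans_le hkd'
  have hμL := hf.le_smoothness (hk.trans_le hkd)
  have hL : 0 < L := hμ.trans_le hμL
  have hR1 : 1 ≤ R := by rwa [hR, one_le_div hk']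
  have hγ : 0 < γ := by
    by_contra! h
    nlinarith
  have hQ1 := mul_sq_le_sum_sq hξ.le T
  have hQ : 0 < ∑ t ∈ Finset.Icc 1 T, (ξ + t) ^ 2 := by
    have hT' : (0 : ℝ) < T := by exact_mod_cast hT
    exact lt_of_lt_of_le (by positivity) hQ1
  have hmem : ∀ n ≤ T, MemLp (parameters F k η w₁ g θ n) 2 P ∧
      MemLp (meanError F k η w₁ g θ n) 2 P := memLp_parameters_meanError hW hg hθ hL2
  have hw : ∀ t ∈ Finset.Icc 1 T, MemLp (parameters F k η w₁ g θ (t - 1)) 2 P := by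
    intro t ht
    have := (Finset.mem_Icc.1 ht).2
    exact (hmem _ (by omega)).1
  obtain ⟨hint, hjensen⟩ := integrable_and_integral_average_sub_le hμ hf hmin (Finset.Icc 1 T)
    (a := fun t => (ξ + t) ^ 2) (fun t _ => sq_nonneg _) hQ hw
  refine ⟨hint, hjensen.trans ?_⟩
  set K : ℝ := 8 * (1 + 8 / (k / (16 * d) * ξ)) ^ 2 / (k / (16 * d)) ^ 2 with hK
  set D : ℕ → ℝ := fun n => ∫ ω, ‖parameters F k η w₁ g θ n ω - meanError F k η w₁ g θ n ω
    - wstar‖ ^ 2 ∂P with hDdef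
  have hrec : ∀ n, n + 1 ≤ T → D (n + 1) ≤ (1 - γ / ((n + 1 : ℕ) + ξ) * μ / 2) * D n
      - γ / ((n + 1 : ℕ) + ξ) *
        ((∫ ω, f (parameters F k η w₁ g θ (n + 1 - 1) ω) ∂P) - f wstar)
      + 2 * σ ^ 2 * (γ / ((n + 1 : ℕ) + ξ)) ^ 2
      + (9 * L * K * G ^ 2 + 32 * L * G ^ 2) * (γ / ((n + 1 : ℕ) + ξ)) ^ 3 := by
    intro n hn
    have ht : n + 1 ∈ Set.Icc 1 T := ⟨by omega, hn⟩
    have hη0 : 0 ≤ η (n + 1) := by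
      rw [hη]
      positivity
    have hmeas := measurable_parameters_meanError (F := F) (k := k) (η := η) (w₁ := w₁) (g := g)
      (θ := θ) hW n
    have h := integral_descent_step (P := P) (history_le hg hθ (n + 1)) hμ hμL hf hmin
      (hmem n (by omega)).1 (hmem n (by omega)).2 (hL2 _ ht) hmeas.1 hmeas.2 (hcond _ ht) hη0
      (hG _ ht) (hσ _ ht)
    have he := integral_meanError_sq_le (w₁ := w₁) hW hk hkd hc hr hξ hη hg hθ hL2 hunif hind hG n
      (by omega)
    have he' := mul_le_mul_of_nonneg_left he (show 0 ≤ 9 * L * η (n + 1) by positivity)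
    have e1 : D (n + 1) = ∫ ω, ‖parameters F k η w₁ g θ n ω - meanError F k η w₁ g θ n ω
        - η (n + 1) • (average fun i => g (n + 1) i ω) - wstar‖ ^ 2 ∂P := by
      simp only [hDdef, parameters_sub_meanError_succ hW]
    rw [e1, ← hη (n + 1), Nat.add_sub_cancel]
    refine h.trans ?_
    simp only [hDdef]
    linarith
  have htel := weighted_sum_le (D := D) hξ hγ hγμ (fun n => integral_nonneg fun ω => sq_nonneg _)
    (Δ := fun t => (∫ ω, f (parameters F k η w₁ g θ (t - 1) ω) ∂P) - f wstar) hrec T le_rfl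
  have hDT : 0 ≤ (ξ + T) ^ 3 / γ * D T :=
    mul_nonneg (by positivity) (integral_nonneg fun ω => sq_nonneg _)
  have hD0 : D 0 = ‖w₁ - wstar‖ ^ 2 := by
    simp [hDdef, parameters_zero, meanError_zero]
  -- The constant vector ∇f(w₁) is the conditional mean of the first gradient, so Jensen's
  -- inequality gives ‖∇f(w₁)‖² ≤ G².
  have hgrad : μ ^ 2 * D 0 ≤ G ^ 2 := by
    have ht : 1 ∈ Set.Icc 1 T := ⟨le_rfl, hT⟩
    rw [hD0]
    refine (hf.mul_norm_sub_min_le hμ.le hmin w₁).trans ?_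
    have h := integral_norm_gradient_sq_le (history_le hg hθ 1) (hL2 1 ht)
      (memLp_const (gradient f w₁)) measurable_const (hcond 1 ht)
    simp only [integral_const, probReal_univ, one_smul] at h
    exact h.trans (hG 1 ht)
  have hKR : K ≤ 2048 * (1 + 128 * Z) ^ 2 * R ^ 2 := by
    -- Here τ = 1/(16R), so 8/τ² = 2048R² and 8/(τξ) = 128R/ξ.
    have e1 : K = 2048 * (1 + 128 * (R / ξ)) ^ 2 * R ^ 2 := by
      rw [hK, hR]
      field_simp
      ring
    have e2 : R / ξ ≤ Z := by rwa [div_le_iff₀ hξ]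
    rw [e1]
    gcongr
  refine le_trans ?_ (rate_le (σ := σ) hT hμ hμL hR1 hξ hξA hγμ hγA hgrad
    (by rw [hD0]; positivity) (by positivity) hKR hQ1 (cube_le_sum_sq hξ.le T) (sum_shift_le ξ T))
  gcongr
  linarith

end Convergence

end SketchedSGD

/-! ### The theorem: choice of the constants -/

theorem mainTheorem3 :
    ∃ c₀ : ℝ, 0 < c₀ ∧
    -- convergence, in expectation over the stochastic gradients and over the sketching
    (∀ β A : ℝ, 4 < β → ∃ C : ℝ, 0 < C ∧
      ∀ (d k W T r c : ℕ), 0 < k → k ≤ d → 0 < W → 0 < T →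
      -- the sketch has `r` rows and `c` columns
      c₀ * k ≤ c → c₀ * (1 + Real.log (d * T)) ≤ r →
      ∀ (F : SketchedSGD.HashFamily d c)
        (f : EuclideanSpace ℝ (Fin d) → ℝ) (L μ : ℝ), 0 < μ →
        SketchedSGD.IsSmoothStronglyConvex f L μ →
      ∀ wstar : EuclideanSpace ℝ (Fin d), (∀ w, f wstar ≤ f w) →
      -- the step sizes
      ∀ ρ ξ γ : ℝ, ρ = 4 * β / ((β - 4) * (β + 1) ^ 2) →
        2 + d * (1 + β) / (k * (1 + ρ)) < ξ → ξ ≤ A * (d / k) →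
        8 ≤ γ * μ → γ * μ ≤ A →
      ∀ η : ℕ → ℝ, (∀ t : ℕ, η t = γ / (t + ξ)) →
      -- the run of the algorithm
      ∀ {Ω : Type*} [MeasurableSpace Ω] (P : Measure Ω) [IsProbabilityMeasure P]
        (w₁ : EuclideanSpace ℝ (Fin d))
        (g : ℕ → Fin W → Ω → EuclideanSpace ℝ (Fin d))
        (θ : ℕ → Ω → SketchedSGD.Seed F r)
        (w : ℕ → Ω → EuclideanSpace ℝ (Fin d)) (what : Ω → EuclideanSpace ℝ (Fin d)),
        (∀ t ω, w t ω =
          SketchedSGD.iterate F k η w₁ (fun s i => g s i ω) (fun s => θ s ω) t) →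
        (∀ ω, what ω =
          SketchedSGD.output F k η ξ w₁ (fun s i => g s i ω) (fun s => θ s ω) T) →
      -- the sketching randomness is uniform, and fresh in each iteration
        (∀ t i, Measurable (g t i)) →
        (∀ t, Measurable[_, ⊤] (θ t)) →
        (∀ t ∈ Set.Icc 1 T, ∀ q : SketchedSGD.Seed F r,
          P (θ t ⁻¹' {q}) = (Fintype.card (SketchedSGD.Seed F r) : ENNReal)⁻¹) →
        (∀ t ∈ Set.Icc 1 T, Indep (MeasurableSpace.comap (θ t) ⊤)
          (SketchedSGD.history g θ t ⊔ SketchedSGD.gradientInfo g t) P) →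
      -- the averaged stochastic gradients are unbiased, with bounded second moment and variance
      ∀ (G σ : ℝ) (gbar : ℕ → Ω → EuclideanSpace ℝ (Fin d)), 0 ≤ G → 0 ≤ σ →
        (∀ t ω, gbar t ω = SketchedSGD.average fun i => g t i ω) →
        (∀ t ∈ Set.Icc 1 T, MemLp (gbar t) 2 P) →
        (∀ t ∈ Set.Icc 1 T,
          P[gbar t | SketchedSGD.history g θ t] =ᵐ[P] fun ω => gradient f (w t ω)) →
        (∀ t ∈ Set.Icc 1 T,
          P[fun ω => ‖gbar t ω‖ ^ 2 | SketchedSGD.history g θ t] ≤ᵐ[P] fun _ => G ^ 2) →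
        (∀ t ∈ Set.Icc 1 T,
          P[fun ω => ‖gbar t ω - gradient f (w t ω)‖ ^ 2 | SketchedSGD.history g θ t]
            ≤ᵐ[P] fun _ => σ ^ 2) →
      Integrable (fun ω => f (what ω)) P ∧
        (∫ ω, f (what ω) ∂P) - f wstar ≤
          C * (σ ^ 2 / (μ * T) + d ^ 2 * G ^ 2 * L / (k ^ 2 * μ ^ 2 * T ^ 2)
            + d ^ 3 * G ^ 3 / (k ^ 3 * μ * T ^ 3))) ∧
    -- communication per update: with `b` bits per number and a sketch with order `k` columns and
    -- order `log (d T)` rows, it is of order `k log (d T) W`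
    (∀ (A : ℝ) (b : ℕ), 0 < b → ∃ m M : ℝ, 0 < m ∧ 0 < M ∧
      ∀ (d k W T r c : ℕ), 0 < k → k ≤ d → 0 < W → 0 < T →
      c₀ * k ≤ c → c ≤ A * k →
      c₀ * (1 + Real.log (d * T)) ≤ r → r ≤ A * (1 + Real.log (d * T)) →
      ∀ (F : SketchedSGD.HashFamily d c) (η : ℝ) (θ : SketchedSGD.Seed F r)
        (g : Fin W → EuclideanSpace ℝ (Fin d)) (s : SketchedSGD.State d W),
        m * (k * (1 + Real.log (d * T)) * W) ≤ SketchedSGD.communication b F k θ η g s ∧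
          SketchedSGD.communication b F k θ η g s ≤
            M * (k * (1 + Real.log (d * T)) * W)) := by
  refine ⟨2500, by norm_num, fun β A hβ => ?_, fun A b hb => ?_⟩
  · set ρ₀ : ℝ := 4 * β / ((β - 4) * (β + 1) ^ 2) with hρ₀
    set Z : ℝ := (1 + ρ₀) / (1 + β) with hZdef
    have hβ4 : 0 < β - 4 := by linarith
    have hβ0 : 0 < β := by linarith
    have hρ0 : 0 ≤ ρ₀ := by positivity
    have hZ : 0 ≤ Z := by positivity
    set C₁ : ℝ := A ^ 2 * (1 + 3 * (9 * (2048 * (1 + 128 * Z) ^ 2) + 32)) with hC₁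
    have hC₁0 : 0 ≤ C₁ := by positivity
    -- The constant must be positive before A > 0 is known, which follows only later from 8 ≤ γμ ≤
    -- A; hence |A| and the summand 1.
    refine ⟨8 * |A| + C₁ + 1, by positivity, ?_⟩
    intro d k W T r c hk hkd hW hT hc hr F f L μ hμ hf wstar hmin ρ ξ γ hρ hξ hξA hγμ hγA η hη
      Ω _ P _ w₁ g θ w what hw hwhat hg hθ hunif hind G σ gbar hG hσ hgbar hL2 hcond hG2 hσ2
    have hk' : (0 : ℝ) < k := by exact_mod_cast hk
    have hkd' : (k : ℝ) ≤ d := by exact_mod_cast hkd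
    have hT' : (0 : ℝ) < T := by exact_mod_cast hT
    have hc' : 2500 * k ≤ c := by exact_mod_cast hc
    have hA : 0 < A := by linarith
    have hL : 0 < L := hμ.trans_le (hf.le_smoothness (hk.trans_le hkd))
    rw [hρ] at hξ
    have hfrac : (d : ℝ) * (1 + β) / (k * (1 + ρ₀)) ≤ ξ := by linarith
    have hξ0 : 0 < ξ := by
      have : 0 ≤ (d : ℝ) * (1 + β) / (k * (1 + ρ₀)) := by positivity
      linarith
    -- The lower bound on ξ makes d/(kξ) at most Z = (1 + ρ)/(1 + β), which bounds the ratio 8/(τξ)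
    -- in terms of β alone.
    have hRξ : (d : ℝ) / k ≤ Z * ξ := by
      calc (d : ℝ) / k = Z * (d * (1 + β) / (k * (1 + ρ₀))) := by
            rw [hZdef]
            field_simp
        _ ≤ Z * ξ := by gcongr
    obtain rfl : gbar = fun t ω => SketchedSGD.average fun i => g t i ω :=
      funext fun t => funext fun ω => hgbar t ω
    obtain rfl : w = fun t => SketchedSGD.parameters F k η w₁ g θ (t - 1) :=
      funext fun t => funext fun ω => hw t ω
    obtain rfl : what = fun ω =>
        SketchedSGD.output F k η ξ w₁ (fun s i => g s i ω) (fun s => θ s ω) T :=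
      funext hwhat
    have hle := SketchedSGD.history_le hg hθ
    obtain ⟨hint, hbound⟩ := SketchedSGD.convergence (w₁ := w₁) (G := G) (σ := σ) hW hk hkd hT hc'
      (SketchedSGD.two_mul_add_one_le_five_pow (hk.trans_le hkd) hT hr) hμ hf hmin rfl hZ hRξ hξ0
      hξA hγμ hγA hη hg hθ hunif hind hL2 hcond
      (fun t ht => SketchedSGD.integral_le_of_condExp_le (hle t) (hG2 t ht))
      (fun t ht => SketchedSGD.integral_le_of_condExp_le (hle t) (hσ2 t ht))
    refine ⟨hint, hbound.trans ?_⟩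
    rw [← hC₁]
    have e : ((d : ℝ) / k) ^ 2 * G ^ 2 * L / (μ ^ 2 * T ^ 2)
        = d ^ 2 * G ^ 2 * L / (k ^ 2 * μ ^ 2 * T ^ 2) := by
      field_simp
    rw [e]
    have h1 : 0 ≤ σ ^ 2 / (μ * T) := by positivity
    have h2 : 0 ≤ (d : ℝ) ^ 2 * G ^ 2 * L / (k ^ 2 * μ ^ 2 * T ^ 2) := by positivity
    have h3 : 0 ≤ (d : ℝ) ^ 3 * G ^ 3 / (k ^ 3 * μ * T ^ 3) := by positivity
    calc 8 * A * (σ ^ 2 / (μ * T)) + C₁ * (d ^ 2 * G ^ 2 * L / (k ^ 2 * μ ^ 2 * T ^ 2))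
        ≤ (8 * |A| + C₁ + 1) * (σ ^ 2 / (μ * T))
          + (8 * |A| + C₁ + 1) * (d ^ 2 * G ^ 2 * L / (k ^ 2 * μ ^ 2 * T ^ 2)) := by
          have hAabs := le_abs_self A
          gcongr <;> linarith
      _ ≤ _ := by
          rw [← mul_add]
          exact mul_le_mul_of_nonneg_left (by linarith) (by positivity)
  · refine ⟨2500 ^ 2, A ^ 2 * b + 4 + 2 * b, by norm_num, by positivity, ?_⟩
    intro d k W T r c hk hkd hW hT hc hcA hr hrA F η θ g s
    exact SketchedSGD.communication_bounds hb hk hkd hT hc hcA hr hrA F η θ g s
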